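/- **Theorem.** Work in the universe $V$ of sets with its class $\mathrm{ORD}$ of ordinals. Define by recursion on $\alpha\in\mathrm{ORD}$, simultaneously for all nodes $\kappa\in\mathrm{ORD}$, the class $M^\alpha_\kappa$ of those functions $f$ with domain $\lambda\setminus\kappa=\{\mu:\kappa\le\mu<\lambda\}$, for some ordinal $\lambda>\kappa$, such that for all $\mu\in\mathrm{dom}(f)$ * $f(\mu)$ is a set with $f(\mu)\subseteq\bigcup_{\beta<\alpha}M^\beta_\mu$, and $\mathrm{dom}(g)\subseteq\mathrm{dom}(f)$ for all $g\in f(\mu)$; * $f_{\mu\nu}''f(\mu)\subseteq f(\nu)$ for all $\nu\ge\mu$ in $\mathrm{dom}(f)$. Here, for $\kappa\le\mu$ and $f\in M^\alpha_\kappa$, the transition function is $f_{\kappa\mu}(f)=f\restriction(\mathrm{dom}(f)\setminus\mu)$ if $\mu\in\mathrm{dom}(f)$; otherwise $f_{\kappa\mu}(f)$ is the function with domain $\{\mu\}$ and value $\bigcup_{\nu\in\mathrm{dom}(f)}f_{\nu\mu}''f(\nu)$ (so $f$ is regarded as constant beyond its domain). Let $M_\kappa=\bigcup_\alpha M^\alpha_\kappa$.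 Put $\kappa\models f\in_\alpha g$ iff $\kappa\models f=_\beta h$ for some $h\in g(\kappa)$ and some $\beta<\alpha$; and $\kappa\models f=_\alpha g$ iff for all $\lambda\in\mathrm{dom}(f)\cup\mathrm{dom}(g)$ every $h\in(f_{\kappa\lambda}(f))(\lambda)$ satisfies $\lambda\models h\in_\alpha f_{\kappa\lambda}(g)$ and every $h\in(f_{\kappa\lambda}(g))(\lambda)$ satisfies $\lambda\models h\in_\alpha f_{\kappa\lambda}(f)$. Let $\in$ and $=$ be the unions over $\alpha$ of $\in_\alpha$ and $=_\alpha$, and extend $\kappa\models\varphi$ to all formulas of set theory as usual for Kripke models. Write $M\models\varphi$ if every node forces $\varphi$, for all values of its free variables. Then: 1. $M$ is a Kripke model over $\mathrm{ORD}$: its universes are non-empty, the $f_{\kappa\mu}$ map $M_\kappa$ to $M_\mu$, $f_{\kappa\kappa}$ is the identity on $M_\kappa$, $f_{\mu\nu}\circ f_{\kappa\mu}=f_{\kappa\nu}$ on $M_\kappa$, the $f_{\kappa\mu}$ preserve $\in$ and $=$, and $=$ satisfies the equality axioms. 2. $M$ satisfies every axiom of CZF (Empty, Strong Infinity, Pair,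 Union, Extensionality, Set Induction, Subset Collection, $\Delta_0$ Separation, Strong Collection) and every axiom of IZF $-$ Power Set (Empty, Infinity, Pair, Union, Extensionality, Set Induction, full Separation, Collection); parameters are allowed in all schemas. 3. $M\models\neg\,\text{Power Set}$, where Power Set is the axiom $\forall a\,\exists p\,\forall z\,(z\subseteq a\to z\in p)$. In fact $M$ satisfies: if $a=\{\emptyset\}$ then there is no $p$ with $\forall z\,(z\subseteq a\to z\in p)$. More precisely, let $0_\kappa\in M_\kappa$ be the function with domain $\{\kappa\}$ and value $\emptyset$, let $1\in M_0$ be the function with domain $\{0\}$ and value $\{0_0\}$, and for $\kappa\in\mathrm{ORD}$ let $1_\kappa$ be the function with domain $\kappa+1$ such that $1_\kappa(\lambda)=\emptyset$ for $\lambda<\kappa$ and $1_\kappa(\kappa)=\{0_\kappa\}$. Then $1\in M_0$ and $0\models 1=\{\emptyset\}$, in the sense that $0\models\forall x\,(x\in 1\leftrightarrow\forall y\;y\notin x)$; for every $\kappa$, $1_\kappa\in M_0$ and $0\models 1_\kappa\subseteq 1$; but for every node $\sigma$ and every $x\in M_\sigma$ there is a $\kappa$ with $\sigma\not\models f_{0\sigma}(1_\kappa)\in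 x$. 4. Hence Power Set is not derivable in intuitionistic first-order logic with equality from the axioms of CZF (which include Subset Collection) together with those of IZF $-$ Power Set. -/

import Mathlib

universe u

namespace KripkeCZF

/-! ## The language of set theory and intuitionistic logic -/

/-- First-order formulas in the language `{=, ∈}`. Variables are de Bruijn indices: an index `i`
under `k` quantifiers denotes a bound variable if `i < k`, and the free variable `i - k` if not.
Since intuitionistic connectives are not interdefinable, all of them are primitive. -/
inductive Fml : Type
  | bot : Fml
  | eq (i j : ℕ) : Fml
  | mem (i j : ℕ) : Fml
  | and (φ ψ : Fml) : Fml
  | or (φ ψ : Fml) : Fml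
  | imp (φ ψ : Fml) : Fml
  | all (φ : Fml) : Fml
  | ex (φ : Fml) : Fml

namespace Fml

def neg (φ : Fml) : Fml := φ.imp bot

def iff (φ ψ : Fml) : Fml := (φ.imp ψ).and (ψ.imp φ)

/-- `∀ x ∈ v, φ`; in `φ` the variable `x` has index `0`, while outside the quantifier the bounding
variable `v` has index `i`. -/
def ball (i : ℕ) (φ : Fml) : Fml := all ((mem 0 (i + 1)).imp φ)

/-- `∃ x ∈ v, φ`, with the same conventions as `ball`. -/
def bex (i : ℕ) (φ : Fml) : Fml := ex ((mem 0 (i + 1)).and φ)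

/-- The renaming `ρ`, moved under one quantifier. -/
def liftRen (ρ : ℕ → ℕ) : ℕ → ℕ
  | 0 => 0
  | n + 1 => ρ n + 1

/-- Renaming of the free variables. -/
def rename : (ℕ → ℕ) → Fml → Fml
  | _, bot => bot
  | ρ, eq i j => eq (ρ i) (ρ j)
  | ρ, mem i j => mem (ρ i) (ρ j)
  | ρ, and φ ψ => and (rename ρ φ) (rename ρ ψ)
  | ρ, or φ ψ => or (rename ρ φ) (rename ρ ψ)
  | ρ, imp φ ψ => imp (rename ρ φ) (rename ρ ψ)
  | ρ, all φ => all (rename (liftRen ρ) φ)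
  | ρ, ex φ => ex (rename (liftRen ρ) φ)

/-- `φ`, seen in a context with one more innermost variable. -/
def shift (φ : Fml) : Fml := φ.rename Nat.succ

/-- `φ[t/0]`: the variable `t` is substituted for the variable `0`, which is discharged. -/
def inst (t : ℕ) (φ : Fml) : Fml :=
  φ.rename fun n => match n with
    | 0 => t
    | m + 1 => m

/-- The `Δ₀` formulas: all quantifiers are bounded by a variable. -/
inductive IsDelta0 : Fml → Prop
  | bot : IsDelta0 bot
  | eq (i j : ℕ) : IsDelta0 (eq i j)
  | mem (i j : ℕ) : IsDelta0 (mem i j)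
  | and {φ ψ : Fml} : IsDelta0 φ → IsDelta0 ψ → IsDelta0 (φ.and ψ)
  | or {φ ψ : Fml} : IsDelta0 φ → IsDelta0 ψ → IsDelta0 (φ.or ψ)
  | imp {φ ψ : Fml} : IsDelta0 φ → IsDelta0 ψ → IsDelta0 (φ.imp ψ)
  | ball (i : ℕ) {φ : Fml} : IsDelta0 φ → IsDelta0 (ball i φ)
  | bex (i : ℕ) {φ : Fml} : IsDelta0 φ → IsDelta0 (bex i φ)

end Fml

open Fml in
/-- Natural deduction for intuitionistic first-order logic with equality. `Prf T Γ φ` means that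
`φ` is derivable from the open hypotheses `Γ` and the axioms `T`. Free variables in a member of `T`
are parameters, so that the member stands for its universal closure: it may be used in every
context and generalized upon. -/
inductive Prf (T : Set Fml) : List Fml → Fml → Prop
  | ax {Γ : List Fml} {φ : Fml} : φ ∈ T → Prf T Γ φ
  | hyp {Γ : List Fml} {φ : Fml} : φ ∈ Γ → Prf T Γ φ
  | botE {Γ : List Fml} {φ : Fml} : Prf T Γ bot → Prf T Γ φ
  | andI {Γ : List Fml} {φ ψ : Fml} : Prf T Γ φ → Prf T Γ ψ → Prf T Γ (φ.and ψ)
  | andE₁ {Γ : List Fml} {φ ψ : Fml} : Prf T Γ (φ.and ψ) → Prf T Γ φ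
  | andE₂ {Γ : List Fml} {φ ψ : Fml} : Prf T Γ (φ.and ψ) → Prf T Γ ψ
  | orI₁ {Γ : List Fml} {φ ψ : Fml} : Prf T Γ φ → Prf T Γ (φ.or ψ)
  | orI₂ {Γ : List Fml} {φ ψ : Fml} : Prf T Γ ψ → Prf T Γ (φ.or ψ)
  | orE {Γ : List Fml} {φ ψ χ : Fml} :
      Prf T Γ (φ.or ψ) → Prf T (φ :: Γ) χ → Prf T (ψ :: Γ) χ → Prf T Γ χ
  | impI {Γ : List Fml} {φ ψ : Fml} : Prf T (φ :: Γ) ψ → Prf T Γ (φ.imp ψ)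
  | impE {Γ : List Fml} {φ ψ : Fml} : Prf T Γ (φ.imp ψ) → Prf T Γ φ → Prf T Γ ψ
  | allI {Γ : List Fml} {φ : Fml} : Prf T (Γ.map shift) φ → Prf T Γ (all φ)
  | allE {Γ : List Fml} {φ : Fml} (t : ℕ) : Prf T Γ (all φ) → Prf T Γ (φ.inst t)
  | exI {Γ : List Fml} {φ : Fml} (t : ℕ) : Prf T Γ (φ.inst t) → Prf T Γ (ex φ)
  | exE {Γ : List Fml} {φ ψ : Fml} :
      Prf T Γ (ex φ) → Prf T (φ :: Γ.map shift) ψ.shift → Prf T Γ ψ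
  | eqRefl {Γ : List Fml} (i : ℕ) : Prf T Γ (eq i i)
  | eqSubst {Γ : List Fml} {φ : Fml} {i j : ℕ} :
      Prf T Γ (eq i j) → Prf T Γ (φ.inst i) → Prf T Γ (φ.inst j)

/-! ## The axioms of CZF and IZF -/

section Axioms

open Fml

/-- `v_i = ∅` -/
def isEmpty (i : ℕ) : Fml := all (neg (mem 0 (i + 1)))

/-- `v_i = {∅}` -/
def isSingletonEmpty (i : ℕ) : Fml := all (iff (mem 0 (i + 1)) (isEmpty 0))

/-- `v_i ⊆ v_j` -/
def isSubset (i j : ℕ) : Fml := ball i (mem 0 (j + 1))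

/-- `v_i = v_j ∪ {v_j}` -/
def isSucc (i j : ℕ) : Fml :=
  all (iff (mem 0 (i + 1)) ((mem 0 (j + 1)).or (eq 0 (j + 1))))

/-- `∅ ∈ v_i`, and `x ∪ {x} ∈ v_i` for all `x ∈ v_i` -/
def isInductive (i : ℕ) : Fml :=
  (bex i (isEmpty 0)).and (ball i (bex (i + 1) (isSucc 0 1)))

/-- Empty: `∃ a ∀ x, x ∉ a` -/
def axEmpty : Fml := ex (isEmpty 0)

/-- Extensionality: `∀ x ∀ y (x = y ↔ ∀ z (z ∈ x ↔ z ∈ y))` -/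
def axExt : Fml := all (all (iff (eq 1 0) (all (iff (mem 0 2) (mem 0 1)))))

/-- Pair: `∀ a ∀ b ∃ c ∀ x (x ∈ c ↔ x = a ∨ x = b)` -/
def axPair : Fml := all (all (ex (all (iff (mem 0 1) ((eq 0 3).or (eq 0 2))))))

/-- Union: `∀ a ∃ c ∀ x (x ∈ c ↔ ∃ y ∈ a, x ∈ y)` -/
def axUnion : Fml := all (ex (all (iff (mem 0 1) (bex 2 (mem 1 0)))))

/-- Infinity: there is an inductive set. -/
def axInfinity : Fml := ex (isInductive 0)

/-- Strong Infinity: there is a least inductive set. -/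
def axStrongInfinity : Fml :=
  ex ((isInductive 0).and (all ((isInductive 0).imp (isSubset 1 0))))

/-- `v_i` has a power set, in the weak sense that some `p` has all subsets of `v_i` among its
members: `∃ p ∀ z (z ⊆ v_i → z ∈ p)`. -/
def hasPowerSet (i : ℕ) : Fml := ex (all ((isSubset 0 (i + 2)).imp (mem 0 1)))

/-- Power Set: `∀ a ∃ p ∀ z (z ⊆ a → z ∈ p)` -/
def axPowerSet : Fml := all (hasPowerSet 0)

/-- Set Induction for `φ(x)`: `∀ x ((∀ y ∈ x, φ(y)) → φ(x)) → ∀ x φ(x)`.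
The variables of `φ` are `x` (index `0`) and the parameters (from `1` on). -/
def axSetInd (φ : Fml) : Fml :=
  (all ((ball 0 (φ.rename fun n => if n = 0 then 0 else n + 1)).imp φ)).imp (all φ)

/-- Separation for `φ(x)`: `∀ a ∃ b ∀ x (x ∈ b ↔ x ∈ a ∧ φ(x))`.
The variables of `φ` are `x` (index `0`), `a` (index `1`) and the parameters (from `2` on). -/
def axSep (φ : Fml) : Fml :=
  all (ex (all (iff (mem 0 1)
    ((mem 0 2).and (φ.rename fun n => if n = 0 then 0 else n + 1)))))

/-- Collection for `φ(x, y)`: `∀ a (∀ x ∈ a ∃ y φ(x, y) → ∃ b ∀ x ∈ a ∃ y ∈ b φ(x, y))`.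
The variables of `φ` are `y` (index `0`), `x` (index `1`), `a` (index `2`) and the parameters
(from `3` on). -/
def axColl (φ : Fml) : Fml :=
  all ((ball 0 (ex φ)).imp
    (ex (ball 1 (bex 1 (φ.rename fun n => if n < 2 then n else n + 1)))))

/-- Strong Collection for `φ(x, y)`:
`∀ a (∀ x ∈ a ∃ y φ(x, y) → ∃ b (∀ x ∈ a ∃ y ∈ b φ(x, y) ∧ ∀ y ∈ b ∃ x ∈ a φ(x, y)))`.
The variables of `φ` are as in `axColl`. -/
def axStrongColl (φ : Fml) : Fml :=
  all ((ball 0 (ex φ)).imp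
    (ex ((ball 1 (bex 1 (φ.rename fun n => if n < 2 then n else n + 1))).and
      (ball 0 (bex 2 (φ.rename fun n => match n with
        | 0 => 1
        | 1 => 0
        | m + 2 => m + 3))))))

/-- Subset Collection for `φ(x, y, u)`: `∀ a ∀ b ∃ c ∀ u (∀ x ∈ a ∃ y ∈ b φ(x, y, u) →`
`∃ d ∈ c (∀ x ∈ a ∃ y ∈ d φ(x, y, u) ∧ ∀ y ∈ d ∃ x ∈ a φ(x, y, u)))`.
The variables of `φ` are `y` (index `0`), `x` (index `1`), `u` (index `2`), `b` (index `3`),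
`a` (index `4`) and the parameters (from `5` on). -/
def axSubsetColl (φ : Fml) : Fml :=
  all (all (ex (all
    ((ball 3 (bex 3 (φ.rename fun n => if n < 3 then n else n + 1))).imp
      (bex 1
        ((ball 4 (bex 1 (φ.rename fun n => match n with
            | 0 => 0
            | 1 => 1
            | 2 => 3
            | m + 3 => m + 5))).and
          (ball 0 (bex 5 (φ.rename fun n => match n with
            | 0 => 1
            | 1 => 0
            | 2 => 3
            | m + 3 => m + 5)))))))))

/-- The axioms of CZF. Free variables of a schema instance are universally quantified. -/
inductive CZF : Set Fml
  | empty : CZF axEmpty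
  | strongInfinity : CZF axStrongInfinity
  | pair : CZF axPair
  | union : CZF axUnion
  | ext : CZF axExt
  | setInd (φ : Fml) : CZF (axSetInd φ)
  | subsetColl (φ : Fml) : CZF (axSubsetColl φ)
  | delta0Sep (φ : Fml) : φ.IsDelta0 → CZF (axSep φ)
  | strongColl (φ : Fml) : CZF (axStrongColl φ)

/-- The axioms of IZF without Power Set. -/
inductive IZFMinusPowerSet : Set Fml
  | empty : IZFMinusPowerSet axEmpty
  | infinity : IZFMinusPowerSet axInfinity
  | pair : IZFMinusPowerSet axPair
  | union : IZFMinusPowerSet axUnion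
  | ext : IZFMinusPowerSet axExt
  | setInd (φ : Fml) : IZFMinusPowerSet (axSetInd φ)
  | sep (φ : Fml) : IZFMinusPowerSet (axSep φ)
  | coll (φ : Fml) : IZFMinusPowerSet (axColl φ)

end Axioms

/-! ## Kripke models -/

/-- The data of a Kripke structure for `{=, ∈}` on the nodes `P`. The universes at the nodes are
subsets of one ambient type `X`; only the values of `trans`, `mem`, `eq` on them matter. -/
structure KripkeStructure (P : Type*) (X : Type*) where
  /-- the universe at a node -/
  univ : P → Set X
  /-- the transition function from one node to a later one -/
  trans : P → P → X → X
  /-- `κ ⊨ x ∈ y` -/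
  mem : P → X → X → Prop
  /-- `κ ⊨ x = y` -/
  eq : P → X → X → Prop

namespace KripkeStructure

variable {P X : Type*} [Preorder P]

/-- The laws of a Kripke model: the universes are inhabited, the transition functions form a
functor and preserve the primitive relations, and `=` satisfies the equality axioms. -/
structure IsKripkeModel (M : KripkeStructure P X) : Prop where
  nonempty : ∀ κ, (M.univ κ).Nonempty
  trans_mem : ∀ κ μ, κ ≤ μ → ∀ x ∈ M.univ κ, M.trans κ μ x ∈ M.univ μ
  trans_self : ∀ κ, ∀ x ∈ M.univ κ, M.trans κ κ x = x
  trans_trans : ∀ κ μ ν, κ ≤ μ → μ ≤ ν → ∀ x ∈ M.univ κ,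
    M.trans μ ν (M.trans κ μ x) = M.trans κ ν x
  mem_mono : ∀ κ μ, κ ≤ μ → ∀ x ∈ M.univ κ, ∀ y ∈ M.univ κ,
    M.mem κ x y → M.mem μ (M.trans κ μ x) (M.trans κ μ y)
  eq_mono : ∀ κ μ, κ ≤ μ → ∀ x ∈ M.univ κ, ∀ y ∈ M.univ κ,
    M.eq κ x y → M.eq μ (M.trans κ μ x) (M.trans κ μ y)
  eq_refl : ∀ κ, ∀ x ∈ M.univ κ, M.eq κ x x
  eq_symm : ∀ κ, ∀ x ∈ M.univ κ, ∀ y ∈ M.univ κ, M.eq κ x y → M.eq κ y x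
  eq_trans : ∀ κ, ∀ x ∈ M.univ κ, ∀ y ∈ M.univ κ, ∀ z ∈ M.univ κ,
    M.eq κ x y → M.eq κ y z → M.eq κ x z
  mem_congr_left : ∀ κ, ∀ x ∈ M.univ κ, ∀ y ∈ M.univ κ, ∀ z ∈ M.univ κ,
    M.eq κ x y → M.mem κ x z → M.mem κ y z
  mem_congr_right : ∀ κ, ∀ x ∈ M.univ κ, ∀ y ∈ M.univ κ, ∀ z ∈ M.univ κ,
    M.eq κ x y → M.mem κ z x → M.mem κ z y

/-- The assignment `s` with `x` as new value of the variable `0`. -/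
def push (x : X) (s : ℕ → X) : ℕ → X
  | 0 => x
  | n + 1 => s n

/-- `κ ⊨ φ[s]` -/
def Forces (M : KripkeStructure P X) : P → (ℕ → X) → Fml → Prop
  | _, _, .bot => False
  | κ, s, .eq i j => M.eq κ (s i) (s j)
  | κ, s, .mem i j => M.mem κ (s i) (s j)
  | κ, s, .and φ ψ => M.Forces κ s φ ∧ M.Forces κ s ψ
  | κ, s, .or φ ψ => M.Forces κ s φ ∨ M.Forces κ s ψ
  | κ, s, .imp φ ψ => ∀ μ, κ ≤ μ →
      M.Forces μ (fun n => M.trans κ μ (s n)) φ → M.Forces μ (fun n => M.trans κ μ (s n)) ψ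
  | κ, s, .all φ => ∀ μ, κ ≤ μ → ∀ x ∈ M.univ μ,
      M.Forces μ (push x fun n => M.trans κ μ (s n)) φ
  | κ, s, .ex φ => ∃ x ∈ M.univ κ, M.Forces κ (push x s) φ

/-- `M ⊨ φ`: every node forces `φ` for all values of its free variables. -/
def Models (M : KripkeStructure P X) (φ : Fml) : Prop :=
  ∀ κ, ∀ s : ℕ → X, (∀ n, s n ∈ M.univ κ) → M.Forces κ s φ

end KripkeStructure

/-! ## The full Kripke model on the class of ordinals

The role of the set-theoretic universe is played by `ZFSet.{u}`, whose ordinals are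
`Ordinal.{u}`. -/

noncomputable section

open Ordinal

/-- The function with domain `l \ κ` and values `F μ`, as a set of ordered pairs. -/
def graph (κ l : Ordinal.{u}) (F : Ordinal.{u} → ZFSet.{u}) : ZFSet.{u} :=
  ZFSet.range fun μ : Set.Ico κ l => ZFSet.pair μ.1.toZFSet (F μ.1)

/-- The (ordinals in the) domain of a function `f`. -/
def dom (f : ZFSet.{u}) : Set Ordinal.{u} :=
  {μ | ∃ S, ZFSet.pair μ.toZFSet S ∈ f}

/-- The value `f(μ)` of a function `f`. -/
def val (f : ZFSet.{u}) (μ : Ordinal.{u}) : ZFSet.{u} :=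
  ZFSet.sUnion (ZFSet.sep (fun S => ZFSet.pair μ.toZFSet S ∈ f)
    (ZFSet.sUnion (ZFSet.sUnion f)))

/-- The union of all values of a function `f`. -/
def members (f : ZFSet.{u}) : ZFSet.{u} :=
  ZFSet.sUnion (ZFSet.sep (fun S => ∃ μ : Ordinal.{u}, ZFSet.pair μ.toZFSet S ∈ f)
    (ZFSet.sUnion (ZFSet.sUnion f)))

theorem mem_sUnion_sUnion_of_pair {f a S : ZFSet.{u}} (h : ZFSet.pair a S ∈ f) :
    S ∈ ZFSet.sUnion (ZFSet.sUnion f) := by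
  refine ZFSet.mem_sUnion.2 ⟨{a, S}, ZFSet.mem_sUnion.2 ⟨_, h, ?_⟩, ?_⟩ <;> simp [ZFSet.pair]

theorem mem_val {f g : ZFSet.{u}} {μ : Ordinal.{u}} :
    g ∈ val f μ ↔ ∃ S, ZFSet.pair μ.toZFSet S ∈ f ∧ g ∈ S := by
  simp only [val, ZFSet.mem_sUnion, ZFSet.mem_sep]
  exact ⟨fun ⟨S, h, hg⟩ => ⟨S, h.2, hg⟩, fun ⟨S, h, hg⟩ =>
    ⟨S, ⟨by simpa [ZFSet.mem_sUnion] using mem_sUnion_sUnion_of_pair h, h⟩, hg⟩⟩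

theorem mem_members {f g : ZFSet.{u}} : g ∈ members f ↔ ∃ μ ∈ dom f, g ∈ val f μ := by
  simp only [members, ZFSet.mem_sUnion, ZFSet.mem_sep, mem_val, dom, Set.mem_ofPred_eq]
  constructor
  · rintro ⟨S, ⟨_, μ, h⟩, hg⟩
    exact ⟨μ, ⟨S, h⟩, S, h, hg⟩
  · rintro ⟨μ, _, S, h, hg⟩
    exact ⟨S, ⟨by simpa [ZFSet.mem_sUnion] using mem_sUnion_sUnion_of_pair h, μ, h⟩, hg⟩

theorem rank_lt_of_mem_members {f g : ZFSet.{u}} (h : g ∈ members f) : g.rank < f.rank := by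
  obtain ⟨S, hS, hg⟩ := ZFSet.mem_sUnion.1 h
  calc g.rank < S.rank := ZFSet.rank_lt_of_mem hg
    _ < (ZFSet.sUnion (ZFSet.sUnion f)).rank := ZFSet.rank_lt_of_mem (ZFSet.mem_sep.1 hS).1
    _ ≤ f.rank := (ZFSet.rank_sUnion_le _).trans (ZFSet.rank_sUnion_le _)

open Classical in
/-- The transition function `f_{κμ}` from node `κ` to node `μ`, applied to `f`. If `μ ∈ dom f`, it
is restriction to `dom f \ μ`; if not, its value is the function with domain `{μ}` that sends `μ`
to the union of all `f_{νμ} '' f(ν)` for `ν ∈ dom f`. (Nothing here depends on `κ`.) -/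
def transition (μ : Ordinal.{u}) (f : ZFSet.{u}) : ZFSet.{u} :=
  if μ ∈ dom f then
    ZFSet.sep (fun p => ∃ ν, μ ≤ ν ∧ ∃ S, p = ZFSet.pair ν.toZFSet S) f
  else
    graph μ (μ + 1) fun _ => ZFSet.range fun g : {g // g ∈ members f} => transition μ g.1
termination_by f.rank
decreasing_by exact rank_lt_of_mem_members g.2

/-- `f ∈ M^α_κ`: `f` is a function with domain `l \ κ` for some `l > κ`, and for all `μ ∈ dom f`:
`f(μ) ⊆ ⋃_{β < α} M^β_μ`; `dom g ⊆ dom f` for `g ∈ f(μ)`; and `f_{μν} '' f(μ) ⊆ f(ν)` for all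
`ν ≥ μ` in `dom f`. -/
def IsStage (α κ : Ordinal.{u}) (f : ZFSet.{u}) : Prop :=
  (∃ l F, κ < l ∧ f = graph κ l F) ∧
  ∀ μ ∈ dom f,
    (∀ g ∈ val f μ, ∃ β, ∃ _ : β < α, IsStage β μ g) ∧
    (∀ g ∈ val f μ, dom g ⊆ dom f) ∧
    ∀ ν ∈ dom f, μ ≤ ν → ∀ g ∈ val f μ, transition ν g ∈ val f ν
termination_by α

/-- `κ ⊨ f =_α g`: for all `μ ∈ dom f ∪ dom g`, every `h ∈ (f_{κμ}(f))(μ)` satisfies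
`μ ⊨ h ∈_α f_{κμ}(g)`, and every `h ∈ (f_{κμ}(g))(μ)` satisfies `μ ⊨ h ∈_α f_{κμ}(f)`. Here
`κ ⊨ f ∈_α g` means: `κ ⊨ f =_β h` for some `h ∈ g(κ)` and some `β < α`. The relation is only
of interest for `f`, `g` in the universe at `κ`, so that `dom f ∪ dom g` contains no `μ < κ`. -/
def EqStage (α κ : Ordinal.{u}) (f g : ZFSet.{u}) : Prop :=
  ∀ μ, κ ≤ μ → μ ∈ dom f ∪ dom g →
    (∀ h ∈ val (transition μ f) μ, ∃ k ∈ val (transition μ g) μ, ∃ β, ∃ _ : β < α, EqStage β μ h k) ∧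
    (∀ h ∈ val (transition μ g) μ, ∃ k ∈ val (transition μ f) μ, ∃ β, ∃ _ : β < α, EqStage β μ h k)
termination_by α

/-- `κ ⊨ f ∈_α g` -/
def MemStage (α κ : Ordinal.{u}) (f g : ZFSet.{u}) : Prop :=
  ∃ h ∈ val g κ, ∃ β < α, EqStage β κ f h

/-- The full Kripke model on the class of ordinals: `M_κ = ⋃_α M^α_κ`, and `∈`, `=` are the unions
of the `∈_α`, `=_α`. -/
def ordModel : KripkeStructure Ordinal.{u} ZFSet.{u} where
  univ κ := {f | ∃ α, IsStage α κ f}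
  trans _ μ f := transition μ f
  mem κ f g := ∃ α, MemStage α κ f g
  eq κ f g := ∃ α, EqStage α κ f g

/-- The Kripke set `0` at node `κ`: the function with domain `{κ}` and value `∅`. -/
def zeroAt (κ : Ordinal.{u}) : ZFSet.{u} := graph κ (κ + 1) fun _ => ∅

/-- The Kripke set `1 = {0}` at node `0`: the function with domain `{0}` and value `{0}`. -/
def kripkeOne : ZFSet.{u} := graph 0 1 fun _ => {zeroAt 0}

open Classical in
/-- The Kripke set `1_κ` at node `0`: its domain is `κ + 1`, its value is empty at all `μ < κ`,
and at `κ` it has exactly one member, the Kripke set `0`. -/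
def oneFrom (κ : Ordinal.{u}) : ZFSet.{u} :=
  graph 0 (κ + 1) fun μ => if μ < κ then ∅ else {zeroAt κ}

end

end KripkeCZF

open KripkeCZF

/-! A Kripke set at node `κ` is a coherent family of sets of earlier-built Kripke sets, indexed by a
bounded interval of ordinals and constant afterwards. It is therefore the same thing as a
set-indexed family of generators `g i`, where `g i` enters at a node `ν i ≥ κ`: the members at `μ`
are the images of the generators with `ν i ≤ μ` (`exists_isGenerated`, and conversely
`exists_of_family`). The stages in the definition of `=` disappear as well: `=` is coextensionality
at all later nodes (`ordModel_eq_iff`), because past the domain nothing new enters and because only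
set-many stages are needed below that bound.

After this, each existence axiom is proved by naming generators. Forcing persists and respects `=`,
so a formula need only be checked for a generator at one node (`forces_transfer`). Separation lets
each generator enter at the least node where it satisfies the formula. Strong Collection chooses one
witness per generator. For Subset Collection, a total relation from `a` to `b` yields a map from
generators of `a` to generators of `b`. There are only set-many such maps, and the node at which the
relation appears matters only until all generators of `b` have entered.

Power Set fails because a subset of `1 = {∅}` may wait for any ordinal before it acquires its
member. The `1_κ` thus form a proper class of subsets of `1`, told apart by the node at which they
become inhabited, while a Kripke set has only set-many members at a given node
(`exists_oneFrom_notMem`). Underivability follows by soundness. -/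

namespace KripkeCZF

universe v w

/-! ### Forcing in arbitrary Kripke models, and soundness. -/

namespace KripkeStructure

variable {P : Type v} {X : Type w} {M : KripkeStructure P X}

theorem trans_push (κ μ : P) (x : X) (s : ℕ → X) :
    (fun n => M.trans κ μ (push x s n)) = push (M.trans κ μ x) fun n => M.trans κ μ (s n) := by
  funext n
  cases n <;> rfl

theorem push_comp_liftRen (x : X) (s : ℕ → X) (ρ : ℕ → ℕ) :
    (fun n => push x s (Fml.liftRen ρ n)) = push x fun n => s (ρ n) := by
  funext n
  cases n <;> rfl

theorem push_mem {x : X} {s : ℕ → X} {U : Set X} (hx : x ∈ U) (hs : ∀ n, s n ∈ U) :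
    ∀ n, push x s n ∈ U
  | 0 => hx
  | n + 1 => hs n

theorem eq_push {κ : P} {x y : X} {s t : ℕ → X} (h : M.eq κ x y)
    (hst : ∀ n, M.eq κ (s n) (t n)) : ∀ n, M.eq κ (push x s n) (push y t n)
  | 0 => h
  | n + 1 => hst n

theorem eq_trans_push {κ μ : P} {x y : X} {s t : ℕ → X} (h : M.eq μ (M.trans κ μ x) y)
    (hst : ∀ n, M.eq μ (M.trans κ μ (s n)) (t n)) :
    ∀ n, M.eq μ (M.trans κ μ (push x s n)) (push y t n)
  | 0 => h
  | n + 1 => hst n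

variable [Preorder P]

/-- Forcing of a renamed formula is forcing under the renamed assignment. -/
theorem forces_rename (φ : Fml) :
    ∀ (ρ : ℕ → ℕ) (κ : P) (s : ℕ → X),
      M.Forces κ s (φ.rename ρ) ↔ M.Forces κ (fun n => s (ρ n)) φ := by
  induction φ with
  | bot => intro ρ κ s; rfl
  | eq i j => intro ρ κ s; rfl
  | mem i j => intro ρ κ s; rfl
  | and φ ψ ih₁ ih₂ => intro ρ κ s; exact and_congr (ih₁ ρ κ s) (ih₂ ρ κ s)
  | or φ ψ ih₁ ih₂ => intro ρ κ s; exact or_congr (ih₁ ρ κ s) (ih₂ ρ κ s)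
  | imp φ ψ ih₁ ih₂ =>
    intro ρ κ s
    exact forall₂_congr fun μ _ => imp_congr (ih₁ ρ μ _) (ih₂ ρ μ _)
  | all φ ih =>
    intro ρ κ s
    refine forall₂_congr fun μ _ => forall₂_congr fun x _ => (ih _ μ _).trans ?_
    rw [push_comp_liftRen]
  | ex φ ih =>
    intro ρ κ s
    refine exists_congr fun x => and_congr_right fun _ => (ih _ κ _).trans ?_
    rw [push_comp_liftRen]

theorem forces_shift {φ : Fml} {κ : P} {x : X} {s : ℕ → X} :
    M.Forces κ (push x s) φ.shift ↔ M.Forces κ s φ :=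
  forces_rename φ _ κ _

theorem forces_inst {φ : Fml} {κ : P} {t : ℕ} {s : ℕ → X} :
    M.Forces κ s (φ.inst t) ↔ M.Forces κ (push (s t) s) φ := by
  refine (forces_rename φ _ κ s).trans (Iff.of_eq ?_)
  exact congrArg (fun t => M.Forces κ t φ) (funext fun n => by cases n <;> rfl)

namespace IsKripkeModel


theorem trans_assignment_mem (hM : M.IsKripkeModel) {κ μ : P} (h : κ ≤ μ) {s : ℕ → X}
    (hs : ∀ n, s n ∈ M.univ κ) :
    ∀ n, M.trans κ μ (s n) ∈ M.univ μ :=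
  fun n => hM.trans_mem κ μ h _ (hs n)

theorem trans_trans_assignment (hM : M.IsKripkeModel) {κ μ ν : P} (h : κ ≤ μ) (h' : μ ≤ ν)
    {s : ℕ → X}
    (hs : ∀ n, s n ∈ M.univ κ) :
    (fun n => M.trans μ ν (M.trans κ μ (s n))) = fun n => M.trans κ ν (s n) :=
  funext fun n => hM.trans_trans κ μ ν h h' _ (hs n)

theorem trans_self_assignment (hM : M.IsKripkeModel) {κ : P} {s : ℕ → X}
    (hs : ∀ n, s n ∈ M.univ κ) :
    (fun n => M.trans κ κ (s n)) = s :=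
  funext fun n => hM.trans_self κ _ (hs n)

theorem forces_mono (hM : M.IsKripkeModel) {φ : Fml} : ∀ {κ μ : P}, κ ≤ μ → ∀ {s : ℕ → X},
    (∀ n, s n ∈ M.univ κ) →
    M.Forces κ s φ → M.Forces μ (fun n => M.trans κ μ (s n)) φ := by
  induction φ with
  | bot => intro κ μ _ s _ h; exact h
  | eq i j => intro κ μ h s hs; exact hM.eq_mono κ μ h _ (hs i) _ (hs j)
  | mem i j => intro κ μ h s hs; exact hM.mem_mono κ μ h _ (hs i) _ (hs j)
  | and φ ψ ih₁ ih₂ => intro κ μ h s hs hf; exact ⟨ih₁ h hs hf.1, ih₂ h hs hf.2⟩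
  | or φ ψ ih₁ ih₂ => intro κ μ h s hs hf; exact hf.imp (ih₁ h hs) (ih₂ h hs)
  | imp φ ψ ih₁ ih₂ =>
    intro κ μ h s hs hf ν hν
    rw [hM.trans_trans_assignment h hν hs]
    exact hf ν (h.trans hν)
  | all φ ih =>
    intro κ μ h s hs hf ν hν
    rw [hM.trans_trans_assignment h hν hs]
    exact hf ν (h.trans hν)
  | ex φ ih =>
    rintro κ μ h s hs ⟨x, hx, hf⟩
    have := ih h (push_mem hx hs) hf
    rw [trans_push] at this
    exact ⟨_, hM.trans_mem κ μ h x hx, this⟩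

/-- Transitions preserve `=`, so the hypothesis survives the passage to later nodes made by
implication and the universal quantifier. -/
theorem forces_congr (hM : M.IsKripkeModel) {φ : Fml} : ∀ {κ : P} {s t : ℕ → X},
    (∀ n, s n ∈ M.univ κ) →
    (∀ n, t n ∈ M.univ κ) → (∀ n, M.eq κ (s n) (t n)) →
    (M.Forces κ s φ ↔ M.Forces κ t φ) := by
  induction φ with
  | bot => intro κ s t _ _ _; rfl
  | eq i j =>
    intro κ s t hs ht h
    constructor
    · intro hf
      exact hM.eq_trans κ _ (ht i) _ (hs i) _ (ht j) (hM.eq_symm κ _ (hs i) _ (ht i) (h i))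
        (hM.eq_trans κ _ (hs i) _ (hs j) _ (ht j) hf (h j))
    · intro hf
      exact hM.eq_trans κ _ (hs i) _ (ht i) _ (hs j) (h i)
        (hM.eq_trans κ _ (ht i) _ (ht j) _ (hs j) hf (hM.eq_symm κ _ (hs j) _ (ht j) (h j)))
  | mem i j =>
    intro κ s t hs ht h
    constructor
    · intro hf
      exact hM.mem_congr_left κ _ (hs i) _ (ht i) _ (ht j) (h i)
        (hM.mem_congr_right κ _ (hs j) _ (ht j) _ (hs i) (h j) hf)
    · intro hf
      exact hM.mem_congr_left κ _ (ht i) _ (hs i) _ (hs j)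
        (hM.eq_symm κ _ (hs i) _ (ht i) (h i)) (hM.mem_congr_right κ _ (ht j) _ (hs j) _ (ht i)
          (hM.eq_symm κ _ (hs j) _ (ht j) (h j)) hf)
  | and φ ψ ih₁ ih₂ => intro κ s t hs ht h; exact and_congr (ih₁ hs ht h) (ih₂ hs ht h)
  | or φ ψ ih₁ ih₂ => intro κ s t hs ht h; exact or_congr (ih₁ hs ht h) (ih₂ hs ht h)
  | imp φ ψ ih₁ ih₂ =>
    intro κ s t hs ht h
    refine forall₂_congr fun μ hμ => ?_
    have hs' := hM.trans_assignment_mem hμ hs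
    have ht' := hM.trans_assignment_mem hμ ht
    have h' := fun n => hM.eq_mono κ μ hμ _ (hs n) _ (ht n) (h n)
    exact imp_congr (ih₁ hs' ht' h') (ih₂ hs' ht' h')
  | all φ ih =>
    intro κ s t hs ht h
    refine forall₂_congr fun μ hμ => forall₂_congr fun x hx => ?_
    refine ih (push_mem hx (hM.trans_assignment_mem hμ hs))
      (push_mem hx (hM.trans_assignment_mem hμ ht)) fun n => ?_
    cases n with
    | zero => exact hM.eq_refl μ x hx
    | succ n => exact hM.eq_mono κ μ hμ _ (hs n) _ (ht n) (h n)
  | ex φ ih =>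
    intro κ s t hs ht h
    refine exists_congr fun x => and_congr_right fun hx => ?_
    refine ih (push_mem hx hs) (push_mem hx ht) fun n => ?_
    cases n with
    | zero => exact hM.eq_refl κ x hx
    | succ n => exact h n

/-- Persistence and congruence in one step. It carries a formula from generators, at the nodes where
they enter, to arbitrary sets that later become equal to them. -/
theorem forces_transfer (hM : M.IsKripkeModel) {φ : Fml} {κ μ : P} (h : κ ≤ μ) {s t : ℕ → X}
    (hs : ∀ n, s n ∈ M.univ κ) (ht : ∀ n, t n ∈ M.univ μ)
    (hst : ∀ n, M.eq μ (M.trans κ μ (s n)) (t n)) (hf : M.Forces κ s φ) : M.Forces μ t φ :=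
  (hM.forces_congr (hM.trans_assignment_mem h hs) ht hst).1 (hM.forces_mono h hs hf)

theorem eq_trans_trans (hM : M.IsKripkeModel) {κ μ ν : P} (h : κ ≤ μ) (h' : μ ≤ ν) {x : X}
    (hx : x ∈ M.univ κ) : M.eq ν (M.trans μ ν (M.trans κ μ x)) (M.trans κ ν x) := by
  rw [hM.trans_trans κ μ ν h h' x hx]
  exact hM.eq_refl ν _ (hM.trans_mem κ ν (h.trans h') x hx)

theorem forces_push_congr (hM : M.IsKripkeModel) {φ : Fml} {κ : P} {x y : X} (hx : x ∈ M.univ κ)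
    (hy : y ∈ M.univ κ)
    {s : ℕ → X} (hs : ∀ n, s n ∈ M.univ κ) (h : M.eq κ x y) :
    M.Forces κ (push x s) φ ↔ M.Forces κ (push y s) φ :=
  hM.forces_congr (push_mem hx hs) (push_mem hy hs)
    (eq_push h fun n => hM.eq_refl κ _ (hs n))

theorem forces_imp (hM : M.IsKripkeModel) {φ ψ : Fml} {κ : P} {s : ℕ → X} (hs : ∀ n, s n ∈ M.univ κ)
    (h : M.Forces κ s (φ.imp ψ)) (hφ : M.Forces κ s φ) : M.Forces κ s ψ := by
  have := h κ le_rfl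
  rw [hM.trans_self_assignment hs] at this
  exact this hφ

/-- The implication's own move to a later node is absorbed by the universal quantifier: the
transported `x` is again an instance. -/
theorem forces_all_imp (hM : M.IsKripkeModel) {φ ψ : Fml} {κ : P} {s : ℕ → X}
    (hs : ∀ n, s n ∈ M.univ κ) :
    M.Forces κ s (.all (φ.imp ψ)) ↔ ∀ μ, κ ≤ μ → ∀ x ∈ M.univ μ,
      M.Forces μ (push x fun n => M.trans κ μ (s n)) φ →
      M.Forces μ (push x fun n => M.trans κ μ (s n)) ψ := by
  constructor
  · intro h μ hμ x hx
    exact hM.forces_imp (push_mem hx (hM.trans_assignment_mem hμ hs)) (h μ hμ x hx)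
  · intro h μ hμ x hx ν hν
    rw [trans_push, hM.trans_trans_assignment hμ hν hs]
    exact h ν (hμ.trans hν) _ (hM.trans_mem μ ν hν x hx)

theorem forces_all_iff (hM : M.IsKripkeModel) {φ ψ : Fml} {κ : P} {s : ℕ → X}
    (hs : ∀ n, s n ∈ M.univ κ) :
    M.Forces κ s (.all (φ.iff ψ)) ↔ ∀ μ, κ ≤ μ → ∀ x ∈ M.univ μ,
      (M.Forces μ (push x fun n => M.trans κ μ (s n)) φ ↔
      M.Forces μ (push x fun n => M.trans κ μ (s n)) ψ) := by
  constructor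
  · intro h μ hμ x hx
    have hs' := push_mem hx (hM.trans_assignment_mem hμ hs)
    exact ⟨hM.forces_imp hs' (h μ hμ x hx).1, hM.forces_imp hs' (h μ hμ x hx).2⟩
  · intro h μ hμ x hx
    refine ⟨fun ν hν => ?_, fun ν hν => ?_⟩ <;>
      rw [trans_push, hM.trans_trans_assignment hμ hν hs]
    · exact (h ν (hμ.trans hν) _ (hM.trans_mem μ ν hν x hx)).1
    · exact (h ν (hμ.trans hν) _ (hM.trans_mem μ ν hν x hx)).2

theorem models_all (hM : M.IsKripkeModel) {φ : Fml}
    (h : ∀ κ, ∀ s : ℕ → X, (∀ n, s n ∈ M.univ κ) → ∀ x ∈ M.univ κ, M.Forces κ (push x s) φ) :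
    M.Models (.all φ) :=
  fun _ _ hs μ hμ x hx => h μ _ (hM.trans_assignment_mem hμ hs) x hx

theorem models_imp (hM : M.IsKripkeModel) {φ ψ : Fml}
    (h : ∀ κ, ∀ s : ℕ → X, (∀ n, s n ∈ M.univ κ) → M.Forces κ s φ → M.Forces κ s ψ) :
    M.Models (φ.imp ψ) :=
  fun _ _ hs μ hμ => h μ _ (hM.trans_assignment_mem hμ hs)

/-- Soundness of intuitionistic logic with equality for Kripke models. -/
theorem sound (hM : M.IsKripkeModel) {T : Set Fml} (hT : ∀ φ ∈ T, M.Models φ) {Γ : List Fml}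
    {φ : Fml}
    (h : Prf T Γ φ) : ∀ κ, ∀ s : ℕ → X, (∀ n, s n ∈ M.univ κ) →
      (∀ ψ ∈ Γ, M.Forces κ s ψ) → M.Forces κ s φ := by
  induction h with
  | ax h => exact fun κ s hs _ => hT _ h κ s hs
  | hyp h => exact fun κ s _ hΓ => hΓ _ h
  | botE _ ih => exact fun κ s hs hΓ => (ih κ s hs hΓ).elim
  | andI _ _ ih₁ ih₂ => exact fun κ s hs hΓ => ⟨ih₁ κ s hs hΓ, ih₂ κ s hs hΓ⟩
  | andE₁ _ ih => exact fun κ s hs hΓ => (ih κ s hs hΓ).1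
  | andE₂ _ ih => exact fun κ s hs hΓ => (ih κ s hs hΓ).2
  | orI₁ _ ih => exact fun κ s hs hΓ => Or.inl (ih κ s hs hΓ)
  | orI₂ _ ih => exact fun κ s hs hΓ => Or.inr (ih κ s hs hΓ)
  | orE _ _ _ ih ih₁ ih₂ =>
    intro κ s hs hΓ
    rcases ih κ s hs hΓ with h | h
    · exact ih₁ κ s hs (List.forall_mem_cons.2 ⟨h, hΓ⟩)
    · exact ih₂ κ s hs (List.forall_mem_cons.2 ⟨h, hΓ⟩)
  | impI _ ih =>
    intro κ s hs hΓ μ hμ h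
    exact ih μ _ (hM.trans_assignment_mem hμ hs)
      (List.forall_mem_cons.2 ⟨h, fun ψ hψ => hM.forces_mono hμ hs (hΓ ψ hψ)⟩)
  | impE _ _ ih₁ ih₂ =>
    exact fun κ s hs hΓ => hM.forces_imp hs (ih₁ κ s hs hΓ) (ih₂ κ s hs hΓ)
  | allI _ ih =>
    intro κ s hs hΓ μ hμ x hx
    refine ih μ _ (push_mem hx (hM.trans_assignment_mem hμ hs)) fun ψ hψ => ?_
    obtain ⟨χ, hχ, rfl⟩ := List.mem_map.1 hψ
    exact forces_shift.2 (hM.forces_mono hμ hs (hΓ χ hχ))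
  | allE t _ ih =>
    intro κ s hs hΓ
    have := ih κ s hs hΓ κ le_rfl (s t) (hs t)
    rw [hM.trans_self_assignment hs] at this
    exact forces_inst.2 this
  | exI t _ ih => exact fun κ s hs hΓ => ⟨s t, hs t, forces_inst.1 (ih κ s hs hΓ)⟩
  | exE _ _ ih₁ ih₂ =>
    intro κ s hs hΓ
    obtain ⟨x, hx, h⟩ := ih₁ κ s hs hΓ
    refine forces_shift.1 (ih₂ κ (push x s) (push_mem hx hs)
      (List.forall_mem_cons.2 ⟨h, fun ψ hψ => ?_⟩))
    obtain ⟨χ, hχ, rfl⟩ := List.mem_map.1 hψ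
    exact forces_shift.2 (hΓ χ hχ)
  | eqRefl i => exact fun κ s hs _ => hM.eq_refl κ _ (hs i)
  | eqSubst _ _ ih₁ ih₂ =>
    intro κ s hs hΓ
    exact forces_inst.2 ((hM.forces_push_congr (hs _) (hs _) hs (ih₁ κ s hs hΓ)).1
      (forces_inst.1 (ih₂ κ s hs hΓ)))

end IsKripkeModel

end KripkeStructure

/-! ### Functions on intervals of ordinals and their restrictions. -/

noncomputable section

open Ordinal

variable {κ l μ ν : Ordinal.{u}} {F : Ordinal.{u} → ZFSet.{u}} {f g h : ZFSet.{u}}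

theorem pair_mem_graph {S : ZFSet.{u}} :
    ZFSet.pair μ.toZFSet S ∈ graph κ l F ↔ μ ∈ Set.Ico κ l ∧ S = F μ := by
  simp only [graph, ZFSet.mem_range, ZFSet.pair_inj]
  constructor
  · rintro ⟨⟨ν, hν⟩, h, rfl⟩
    obtain rfl := toZFSet_injective h
    exact ⟨hν, rfl⟩
  · rintro ⟨hμ, rfl⟩
    exact ⟨⟨μ, hμ⟩, rfl, rfl⟩

theorem dom_graph : dom (graph κ l F) = Set.Ico κ l := by
  ext μ
  simp [dom, pair_mem_graph]

theorem val_graph (hμ : μ ∈ Set.Ico κ l) : val (graph κ l F) μ = F μ := by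
  ext g
  simp [mem_val, pair_mem_graph, Set.mem_Ico.1 hμ]

theorem mem_members_graph : g ∈ members (graph κ l F) ↔ ∃ μ ∈ Set.Ico κ l, g ∈ F μ := by
  rw [mem_members, dom_graph]
  exact exists_congr fun μ => and_congr_right fun hμ => by rw [val_graph hμ]

theorem transition_graph (hμ : μ ∈ Set.Ico κ l) :
    transition μ (graph κ l F) = graph μ l F := by
  rw [transition, if_pos (by rwa [dom_graph])]
  ext p
  simp only [ZFSet.mem_sep, graph, ZFSet.mem_range]
  constructor
  · rintro ⟨⟨⟨ν, hν⟩, rfl⟩, ν', hν', S, hS⟩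
    obtain rfl := toZFSet_injective (ZFSet.pair_inj.1 hS).1
    exact ⟨⟨ν, hν', hν.2⟩, rfl⟩
  · rintro ⟨⟨ν, hν⟩, rfl⟩
    exact ⟨⟨⟨ν, hμ.1.trans hν.1, hν.2⟩, rfl⟩, ν, hν.1, _, rfl⟩

theorem transition_of_notMem (hμ : μ ∉ dom f) : transition μ f = graph μ (μ + 1) fun _ =>
    ZFSet.range fun g : {g // g ∈ members f} => transition μ g.1 := by
  rw [transition, if_neg hμ]

theorem mem_Ico_add_one : ν ∈ Set.Ico μ (μ + 1) ↔ ν = μ := by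
  rw [Set.mem_Ico, Order.lt_add_one_iff]
  exact ⟨fun h => le_antisymm h.2 h.1, fun h => ⟨h.ge, h.le⟩⟩

/-! ### The universes -/

theorem eq_graph_of_mem_univ (hf : f ∈ ordModel.univ κ) :
    ∃ l F, κ < l ∧ f = graph κ l F := by
  obtain ⟨α, hα⟩ := hf
  rw [IsStage] at hα
  exact hα.1

/-- Membership in a universe without mention of stages: the values form a set, so the stages of all
their members have a common strict upper bound. -/
theorem graph_mem_univ_iff (hl : κ < l) : graph κ l F ∈ ordModel.univ κ ↔
    ∀ μ ∈ Set.Ico κ l, (∀ g ∈ F μ, g ∈ ordModel.univ μ) ∧ (∀ g ∈ F μ, dom g ⊆ Set.Ico κ l) ∧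
      ∀ ν ∈ Set.Ico κ l, μ ≤ ν → ∀ g ∈ F μ, transition ν g ∈ F ν := by
  constructor
  · rintro ⟨α, hα⟩ μ hμ
    rw [IsStage, dom_graph] at hα
    obtain ⟨h₁, h₂, h₃⟩ := hα.2 μ hμ
    rw [val_graph hμ] at h₁ h₂ h₃
    refine ⟨fun g hg => ?_, h₂, fun ν hν hμν g hg => ?_⟩
    · obtain ⟨β, _, hβ⟩ := h₁ g hg
      exact ⟨β, hβ⟩
    · rw [← val_graph (F := F) hν]
      exact h₃ ν hν hμν g hg
  · intro h
    have h₁ : ∀ i : (Σ μ : Set.Ico κ l, {g // g ∈ F μ.1}), ∃ α, IsStage α i.1.1 i.2.1 :=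
      fun i => (h i.1.1 i.1.2).1 i.2.1 i.2.2
    choose α hα using h₁
    have : ∀ x : ZFSet.{u}, Small.{u} {g // g ∈ x} := ZFSet.small_coe
    refine ⟨⨆ i, α i + 1, ?_⟩
    rw [IsStage, dom_graph]
    refine ⟨⟨l, F, hl, rfl⟩, fun μ hμ => ?_⟩
    rw [val_graph hμ]
    refine ⟨fun g hg => ⟨_, Ordinal.lt_iSup_add_one α ⟨⟨μ, hμ⟩, g, hg⟩, hα _⟩, (h μ hμ).2.1, ?_⟩
    intro ν hν hμν g hg
    rw [val_graph hν]
    exact (h μ hμ).2.2 ν hν hμν g hg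

/-- The members of the values of `f` have smaller rank than `f`. -/
theorem univ_induction {C : Ordinal.{u} → ZFSet.{u} → Prop} {κ : Ordinal.{u}} {f : ZFSet.{u}}
    (h : ∀ κ l F, κ < l → graph κ l F ∈ ordModel.univ κ →
      (∀ μ ∈ Set.Ico κ l, ∀ g ∈ F μ, C μ g) → C κ (graph κ l F))
    (hf : f ∈ ordModel.univ κ) : C κ f := by
  obtain ⟨l, F, hl, rfl⟩ := eq_graph_of_mem_univ hf
  refine h κ l F hl hf fun μ hμ g hg => ?_
  exact univ_induction h (((graph_mem_univ_iff hl).1 hf μ hμ).1 g hg)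
termination_by f.rank
decreasing_by
  subst_vars
  exact rank_lt_of_mem_members (mem_members_graph.2 ⟨_, hμ, hg⟩)

theorem transition_self (hf : f ∈ ordModel.univ κ) : transition κ f = f := by
  obtain ⟨l, F, hl, rfl⟩ := eq_graph_of_mem_univ hf
  exact transition_graph ⟨le_rfl, hl⟩

theorem transition_transition (hf : f ∈ ordModel.univ κ) (hκμ : κ ≤ μ) (hμν : μ ≤ ν) :
    transition ν (transition μ f) = transition ν f := by
  revert μ ν
  refine univ_induction
    (C := fun κ f => ∀ {μ ν}, κ ≤ μ → μ ≤ ν → transition ν (transition μ f) = transition ν f)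
    ?_ hf
  intro κ l F hl hf ih μ ν hκμ hμν
  have hF := (graph_mem_univ_iff hl).1 hf
  rcases lt_or_ge ν l with hν | hν
  · rw [transition_graph ⟨hκμ, hμν.trans_lt hν⟩, transition_graph ⟨hμν, hν⟩,
      transition_graph ⟨hκμ.trans hμν, hν⟩]
  · rw [transition_of_notMem (μ := ν) (f := graph κ l F)
      (by rw [dom_graph]; exact fun h => h.2.not_ge hν)]
    rcases lt_or_ge μ l with hμ | hμ
    · rw [transition_graph ⟨hκμ, hμ⟩, transition_of_notMem
        (by rw [dom_graph]; exact fun h => h.2.not_ge hν)]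
      congr 1
      funext _
      ext h
      simp only [ZFSet.mem_range, Subtype.exists, mem_members_graph, exists_prop]
      constructor
      · rintro ⟨g, ⟨ξ, hξ, hg⟩, rfl⟩
        exact ⟨g, ⟨ξ, ⟨hκμ.trans hξ.1, hξ.2⟩, hg⟩, rfl⟩
      · rintro ⟨g, ⟨ξ, hξ, hg⟩, rfl⟩
        -- A member that entered before `μ` may be lost by the restriction, but coherence puts its
        -- image at `μ` into `F μ`, and by induction that image has the same image at `ν`.
        rcases le_total μ ξ with hμξ | hμξ
        · exact ⟨g, ⟨ξ, ⟨hμξ, hξ.2⟩, hg⟩, rfl⟩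
        · exact ⟨transition μ g, ⟨μ, ⟨le_rfl, hμ⟩, (hF ξ hξ).2.2 μ ⟨hκμ, hμ⟩ hμξ g hg⟩,
            ih ξ hξ g hg hμξ hμν⟩
    · rw [transition_of_notMem (μ := μ) (by rw [dom_graph]; exact fun h => h.2.not_ge hμ)]
      rcases hμν.eq_or_lt with rfl | hμν'
      · exact transition_graph (mem_Ico_add_one.2 rfl)
      · rw [transition_of_notMem
          (by rw [dom_graph, mem_Ico_add_one]; exact hμν'.ne')]
        congr 1
        funext _
        ext h
        simp only [ZFSet.mem_range, Subtype.exists, mem_members_graph, exists_prop]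
        constructor
        · rintro ⟨_, ⟨ξ, _, g, ⟨ξ', hξ', hg⟩, rfl⟩, rfl⟩
          exact ⟨g, ⟨ξ', hξ', hg⟩, (ih ξ' hξ' g hg (hξ'.2.le.trans hμ) hμν).symm⟩
        · rintro ⟨g, ⟨ξ', hξ', hg⟩, rfl⟩
          exact ⟨transition μ g, ⟨μ, mem_Ico_add_one.2 rfl, g, ⟨ξ', hξ', hg⟩, rfl⟩,
            ih ξ' hξ' g hg (hξ'.2.le.trans hμ) hμν⟩

/-- Transition cannot enlarge a domain beyond the node it leads to. -/
theorem dom_transition_subset (hf : f ∈ ordModel.univ κ) (hμ : κ ≤ μ) :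
    dom (transition μ f) ⊆ {ξ | μ ≤ ξ ∧ (ξ = μ ∨ ξ ∈ dom f)} := by
  obtain ⟨l, F, hl, rfl⟩ := eq_graph_of_mem_univ hf
  rcases lt_or_ge μ l with hμl | hμl
  · rw [transition_graph ⟨hμ, hμl⟩, dom_graph, dom_graph]
    exact fun ξ hξ => ⟨hξ.1, Or.inr ⟨hμ.trans hξ.1, hξ.2⟩⟩
  · rw [transition_of_notMem (by rw [dom_graph]; exact fun h => h.2.not_ge hμl), dom_graph]
    intro ξ hξ
    obtain rfl := mem_Ico_add_one.1 hξ
    exact ⟨le_rfl, Or.inl rfl⟩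

theorem transition_mem_univ (hf : f ∈ ordModel.univ κ) (hκμ : κ ≤ μ) :
    transition μ f ∈ ordModel.univ μ := by
  revert μ
  refine univ_induction
    (C := fun κ f => ∀ {μ}, κ ≤ μ → transition μ f ∈ ordModel.univ μ) ?_ hf
  intro κ l F hl hf ih μ hκμ
  have hF := (graph_mem_univ_iff hl).1 hf
  rcases lt_or_ge μ l with hμ | hμ
  · rw [transition_graph ⟨hκμ, hμ⟩, graph_mem_univ_iff hμ]
    intro ν hν
    obtain ⟨h₁, h₂, h₃⟩ := hF ν ⟨hκμ.trans hν.1, hν.2⟩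
    refine ⟨h₁, fun g hg ξ hξ => ⟨?_, (h₂ g hg hξ).2⟩, fun ξ hξ => h₃ ξ ⟨hκμ.trans hξ.1, hξ.2⟩⟩
    -- Restriction shrinks the domain from below; this does no harm, since the domain of a member at
    -- `ν` starts at `ν`.
    obtain ⟨l', F', -, rfl⟩ := eq_graph_of_mem_univ (h₁ g hg)
    rw [dom_graph] at hξ
    exact hν.1.trans hξ.1
  · rw [transition_of_notMem (by rw [dom_graph]; exact fun h => h.2.not_ge hμ),
      graph_mem_univ_iff (Order.lt_add_one_iff.2 le_rfl)]
    intro ν hν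
    obtain rfl := mem_Ico_add_one.1 hν
    simp only [ZFSet.mem_range, Subtype.exists, mem_members_graph, exists_prop]
    refine ⟨?_, ?_, ?_⟩
    · rintro _ ⟨g, ⟨ξ, hξ, hg⟩, rfl⟩
      exact ih ξ hξ g hg (hξ.2.le.trans hμ)
    · rintro _ ⟨g, ⟨ξ, hξ, hg⟩, rfl⟩ ξ' hξ'
      rw [mem_Ico_add_one]
      obtain ⟨-, h | h⟩ :=
        dom_transition_subset ((hF ξ hξ).1 g hg) (hξ.2.le.trans hμ) hξ'
      · exact h
      -- This is where the clause `dom g ⊆ dom f` is needed: `dom g` ends by `l ≤ μ`, so the image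
      -- of `g` at `μ` has domain `{μ}`.
      · exact absurd ((hF ξ hξ).2.1 g hg h).2
          (hμ.trans (dom_transition_subset ((hF ξ hξ).1 g hg) (hξ.2.le.trans hμ) hξ').1).not_gt
    · rintro ξ hξ - _ ⟨g, ⟨ξ', hξ', hg⟩, rfl⟩
      obtain rfl := mem_Ico_add_one.1 hξ
      refine ⟨g, ⟨ξ', hξ', hg⟩, ?_⟩
      rw [transition_transition ((hF ξ' hξ').1 g hg) (hξ'.2.le.trans hμ) le_rfl]

/-! ### Elements at later nodes -/

/-- The members at the node `μ` of a Kripke set from an earlier node. -/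
def el (f : ZFSet.{u}) (μ : Ordinal.{u}) : ZFSet.{u} := val (transition μ f) μ

theorem el_graph (hμ : μ ∈ Set.Ico κ l) : el (graph κ l F) μ = F μ := by
  rw [el, transition_graph hμ, val_graph ⟨le_rfl, hμ.2⟩]

theorem mem_el_of_notMem (hμ : μ ∉ dom f) :
    h ∈ el f μ ↔ ∃ g ∈ members f, h = transition μ g := by
  rw [el, transition_of_notMem hμ, val_graph (mem_Ico_add_one.2 rfl)]
  simp [ZFSet.mem_range, eq_comm]

theorem el_transition (hf : f ∈ ordModel.univ κ) (hκμ : κ ≤ μ) (hμν : μ ≤ ν) :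
    el (transition μ f) ν = el f ν := by
  rw [el, transition_transition hf hκμ hμν, el]

/-- The Kripke set `f` at the node `κ` is generated by the family `g`, where `g i` enters at the
node `ν i`. -/
structure IsGenerated {ι : Type*} (κ : Ordinal.{u}) (f : ZFSet.{u}) (ν : ι → Ordinal.{u})
    (g : ι → ZFSet.{u}) : Prop where
  le : ∀ i, κ ≤ ν i
  mem : ∀ i, g i ∈ ordModel.univ (ν i)
  mem_el : ∀ μ, κ ≤ μ → ∀ h, h ∈ el f μ ↔ ∃ i, ν i ≤ μ ∧ h = transition μ (g i)

/-- All members of all values serve as generators, each at its own node. The rank bound permits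
induction through generators, which induction through members at later nodes would not: transition
can raise the rank. -/
theorem exists_isGenerated (hf : f ∈ ordModel.univ κ) :
    ∃ (ι : Type u) (ν : ι → Ordinal.{u}) (g : ι → ZFSet.{u}), IsGenerated κ f ν g ∧
      ∀ i, (g i).rank < f.rank := by
  obtain ⟨l, F, hl, rfl⟩ := eq_graph_of_mem_univ hf
  have hF := (graph_mem_univ_iff hl).1 hf
  have : ∀ x : ZFSet.{u}, Small.{u} {g // g ∈ x} := ZFSet.small_coe
  -- The ordinals below `l` live one universe too high; an index type in `Type u` keeps later
  -- suprema of ordinals bounded.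
  let e := (equivShrink.{u} (Σ μ : Set.Ico κ l, {g // g ∈ F μ.1})).symm
  refine ⟨_, fun i => (e i).1.1, fun i => (e i).2.1, ⟨fun i => (e i).1.2.1, fun i =>
    (hF _ (e i).1.2).1 _ (e i).2.2, fun μ hμ h => ?_⟩, fun i =>
    rank_lt_of_mem_members (mem_members_graph.2 ⟨_, (e i).1.2, (e i).2.2⟩)⟩
  have key : (∃ i, ((e i).1.1 : Ordinal) ≤ μ ∧ h = transition μ (e i).2.1) ↔
      ∃ ν ∈ Set.Ico κ l, ν ≤ μ ∧ ∃ g ∈ F ν, h = transition μ g := by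
    constructor
    · rintro ⟨i, hi, rfl⟩
      exact ⟨_, (e i).1.2, hi, _, (e i).2.2, rfl⟩
    · rintro ⟨ν, hν, hνμ, g, hg, rfl⟩
      refine ⟨e.symm ⟨⟨ν, hν⟩, g, hg⟩, ?_⟩
      rw [Equiv.apply_symm_apply]
      exact ⟨hνμ, rfl⟩
  rw [key]
  rcases lt_or_ge μ l with hμl | hμl
  · rw [el_graph ⟨hμ, hμl⟩]
    constructor
    · intro hh
      exact ⟨μ, ⟨hμ, hμl⟩, le_rfl, h, hh,
        (transition_self ((hF μ ⟨hμ, hμl⟩).1 h hh)).symm⟩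
    · rintro ⟨ν, hν, hνμ, g, hg, rfl⟩
      exact (hF ν hν).2.2 μ ⟨hμ, hμl⟩ hνμ g hg
  · rw [mem_el_of_notMem (by rw [dom_graph]; exact fun h => h.2.not_ge hμl)]
    simp only [mem_members_graph]
    constructor
    · rintro ⟨g, ⟨ν, hν, hg⟩, rfl⟩
      exact ⟨ν, hν, hν.2.le.trans hμl, g, hg, rfl⟩
    · rintro ⟨ν, hν, -, g, hg, rfl⟩
      exact ⟨g, ⟨ν, hν, hg⟩, rfl⟩

/-- Every small family generates a Kripke set. -/
theorem exists_of_family {ι : Type*} [Small.{u} ι] (ν : ι → Ordinal.{u}) (g : ι → ZFSet.{u})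
    (hν : ∀ i, κ ≤ ν i) (hg : ∀ i, g i ∈ ordModel.univ (ν i)) :
    ∃ f ∈ ordModel.univ κ, IsGenerated κ f ν g := by
  choose m G hm hG using fun i => eq_graph_of_mem_univ (hg i)
  -- The domain must contain those of all generators. This also puts every entry node `ν i < m i`
  -- below `l`, so that constancy beyond `l` loses nothing. The term `κ + 1` keeps the domain
  -- non-empty for an empty family.
  let l : Ordinal.{u} := max (κ + 1) (⨆ i, m i + 1)
  have hl : κ < l := (Order.lt_add_one_iff.2 le_rfl).trans_le (le_max_left _ _)
  have hml : ∀ i, m i < l := fun i => (Ordinal.lt_iSup_add_one m i).trans_le (le_max_right _ _)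
  let F : Ordinal.{u} → ZFSet.{u} := fun μ =>
    ZFSet.range fun i : {i // ν i ≤ μ} => transition μ (g i.1)
  have memF : ∀ μ h, h ∈ F μ ↔ ∃ i, ν i ≤ μ ∧ h = transition μ (g i) := by
    intro μ h
    simp [F, ZFSet.mem_range, eq_comm]
  refine ⟨graph κ l F, ?_, hν, hg, fun μ hμ h => ?_⟩
  · rw [graph_mem_univ_iff hl]
    refine fun μ hμ => ⟨fun h hh => ?_, fun h hh ξ hξ => ?_, fun ξ hξ hμξ h hh => ?_⟩ <;>
      obtain ⟨i, hi, rfl⟩ := (memF μ h).1 hh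
    · exact transition_mem_univ (hg i) hi
    · obtain ⟨h₁, h₂⟩ := dom_transition_subset (hg i) hi hξ
      refine ⟨hμ.1.trans h₁, ?_⟩
      rcases h₂ with rfl | h₂
      · exact hμ.2
      · rw [hG i, dom_graph] at h₂
        exact h₂.2.trans (hml i)
    · exact (memF ξ _).2 ⟨i, hi.trans hμξ, transition_transition (hg i) hi hμξ⟩
  · rcases lt_or_ge μ l with hμl | hμl
    · rw [el_graph ⟨hμ, hμl⟩, memF]
    · rw [mem_el_of_notMem (by rw [dom_graph]; exact fun h => h.2.not_ge hμl)]
      simp only [mem_members_graph, memF]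
      constructor
      · rintro ⟨_, ⟨ξ, hξ, i, hi, rfl⟩, rfl⟩
        exact ⟨i, hi.trans (hξ.2.le.trans hμl),
          transition_transition (hg i) hi (hξ.2.le.trans hμl)⟩
      · rintro ⟨i, hi, rfl⟩
        have hil : ν i < l := (hm i).trans (hml i)
        exact ⟨transition (ν i) (g i), ⟨ν i, ⟨hν i, hil⟩, i, le_rfl, rfl⟩,
          (transition_transition (hg i) le_rfl hi).symm⟩

theorem mem_univ_of_mem_el (hf : f ∈ ordModel.univ κ) (hμ : κ ≤ μ) (hh : h ∈ el f μ) :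
    h ∈ ordModel.univ μ := by
  obtain ⟨ι, ν, g, hgen, -⟩ := exists_isGenerated hf
  obtain ⟨i, hi, rfl⟩ := (hgen.mem_el μ hμ h).1 hh
  exact transition_mem_univ (hgen.mem i) hi

theorem transition_mem_el (hf : f ∈ ordModel.univ κ) (hκμ : κ ≤ μ) (hμν : μ ≤ ν)
    (hh : h ∈ el f μ) : transition ν h ∈ el f ν := by
  obtain ⟨ι, ξ, g, hgen, -⟩ := exists_isGenerated hf
  obtain ⟨i, hi, rfl⟩ := (hgen.mem_el μ hκμ h).1 hh
  rw [transition_transition (hgen.mem i) hi hμν]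
  exact (hgen.mem_el ν (hκμ.trans hμν) _).2 ⟨i, hi.trans hμν, rfl⟩

/-! ### Equality and membership -/

theorem eqStage_iff {α : Ordinal.{u}} : EqStage α κ f g ↔ ∀ μ, κ ≤ μ → μ ∈ dom f ∪ dom g →
    (∀ h ∈ el f μ, ∃ k ∈ el g μ, ∃ β < α, EqStage β μ h k) ∧
    (∀ h ∈ el g μ, ∃ k ∈ el f μ, ∃ β < α, EqStage β μ h k) := by
  rw [EqStage]
  simp only [el, exists_prop]

theorem eqStage_symm {α : Ordinal.{u}} (h : EqStage α κ f g) : EqStage α κ g f := by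
  rw [eqStage_iff] at h ⊢
  exact fun μ hμ hd => (h μ hμ (Or.symm hd)).symm

theorem exists_el_of_notMem_dom (hf : f ∈ ordModel.univ κ) (hμ : κ ≤ μ) (hd : μ ∉ dom f)
    (hh : h ∈ el f μ) : ∃ ξ ∈ dom f, κ ≤ ξ ∧ ξ ≤ μ ∧ ∃ g ∈ el f ξ, h = transition μ g := by
  obtain ⟨l, F, hl, rfl⟩ := eq_graph_of_mem_univ hf
  obtain ⟨g, hg, rfl⟩ := (mem_el_of_notMem hd).1 hh
  obtain ⟨ξ, hξ, hg⟩ := mem_members_graph.1 hg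
  rw [dom_graph] at hd ⊢
  refine ⟨ξ, hξ, hξ.1, hξ.2.le.trans (not_lt.1 fun h => hd ⟨hμ, h⟩), g, ?_, rfl⟩
  rwa [el_graph hξ]

/-- At every stage, equality controls the members at all later nodes, not only at those in the
domains. -/
theorem eqStage_extend {α κ μ : Ordinal.{u}} {f g : ZFSet.{u}} (hf : f ∈ ordModel.univ κ)
    (hg : g ∈ ordModel.univ κ)
    (h : EqStage α κ f g) (hμ : κ ≤ μ) :
    ∀ x ∈ el f μ, ∃ y ∈ el g μ, ∃ β < α, EqStage β μ x y := by
  have h' := eqStage_iff.1 h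
  intro x hx
  by_cases hd : μ ∈ dom f
  · exact (h' μ hμ (Or.inl hd)).1 x hx
  · obtain ⟨ξ, hξ, hκξ, hξμ, x', hx', rfl⟩ := exists_el_of_notMem_dom hf hμ hd hx
    obtain ⟨y', hy', β, hβ, hxy⟩ := (h' ξ hκξ (Or.inl hξ)).1 x' hx'
    refine ⟨_, transition_mem_el hg hκξ hξμ hy', β, hβ, ?_⟩
    have hxu := mem_univ_of_mem_el hf hκξ hx'
    have hyu := mem_univ_of_mem_el hg hκξ hy'
    -- It remains to move the equality of `x'` and `y'` from `ξ` to `μ` without raising `β`.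
    -- Transition may have put nodes outside both old domains into the new ones; the recursive call
    -- at `β < α` covers these.
    rw [eqStage_iff]
    intro ν hν _
    rw [el_transition hxu hξμ hν, el_transition hyu hξμ hν]
    exact ⟨eqStage_extend hxu hyu hxy (hξμ.trans hν),
      eqStage_extend hyu hxu (eqStage_symm hxy) (hξμ.trans hν)⟩
termination_by α

/-- Below the bounds of the two domains there are only set-many pairs of a node and a member, so one
stage exceeds all those required. -/
theorem exists_eqStage_of_forall (hf : f ∈ ordModel.univ κ) (hg : g ∈ ordModel.univ κ)
    (h : ∀ μ, κ ≤ μ → ∀ x ∈ el f μ, ∃ y ∈ el g μ, ordModel.eq μ x y) :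
    ∃ α, ∀ μ, κ ≤ μ → μ ∈ dom f ∪ dom g →
      ∀ x ∈ el f μ, ∃ y ∈ el g μ, ∃ β < α, EqStage β μ x y := by
  obtain ⟨l, F, hl, rfl⟩ := eq_graph_of_mem_univ hf
  obtain ⟨l', G, hl', rfl⟩ := eq_graph_of_mem_univ hg
  choose y hy β hβ using fun i : (Σ μ : Set.Ico κ (max l l'), {x // x ∈ el (graph κ l F) μ.1}) =>
    h i.1.1 i.1.2.1 i.2.1 i.2.2
  have : ∀ x : ZFSet.{u}, Small.{u} {g // g ∈ x} := ZFSet.small_coe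
  refine ⟨⨆ i, β i + 1, fun μ hμ hd x hx => ?_⟩
  have hμl : μ < max l l' := by
    rw [dom_graph, dom_graph] at hd
    rcases hd with hd | hd
    · exact hd.2.trans_le (le_max_left _ _)
    · exact hd.2.trans_le (le_max_right _ _)
  let i : (Σ μ : Set.Ico κ (max l l'), {x // x ∈ el (graph κ l F) μ.1}) := ⟨⟨μ, hμ, hμl⟩, x, hx⟩
  exact ⟨y i, hy i, β i, Ordinal.lt_iSup_add_one β i, hβ i⟩

theorem ordModel_eq_iff (hf : f ∈ ordModel.univ κ) (hg : g ∈ ordModel.univ κ) :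
    ordModel.eq κ f g ↔ ∀ μ, κ ≤ μ →
      (∀ x ∈ el f μ, ∃ y ∈ el g μ, ordModel.eq μ x y) ∧
      (∀ x ∈ el g μ, ∃ y ∈ el f μ, ordModel.eq μ x y) := by
  constructor
  · rintro ⟨α, hα⟩ μ hμ
    refine ⟨fun x hx => ?_, fun x hx => ?_⟩
    · obtain ⟨y, hy, β, -, hβ⟩ := eqStage_extend hf hg hα hμ x hx
      exact ⟨y, hy, β, hβ⟩
    · obtain ⟨y, hy, β, -, hβ⟩ := eqStage_extend hg hf (eqStage_symm hα) hμ x hx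
      exact ⟨y, hy, β, hβ⟩
  · intro h
    obtain ⟨α, hα⟩ := exists_eqStage_of_forall hf hg fun μ hμ => (h μ hμ).1
    obtain ⟨β, hβ⟩ := exists_eqStage_of_forall hg hf fun μ hμ => (h μ hμ).2
    refine ⟨max α β, eqStage_iff.2 fun μ hμ hd => ⟨fun x hx => ?_, fun x hx => ?_⟩⟩
    · obtain ⟨y, hy, γ, hγ, hxy⟩ := hα μ hμ hd x hx
      exact ⟨y, hy, γ, hγ.trans_le (le_max_left _ _), hxy⟩
    · obtain ⟨y, hy, γ, hγ, hxy⟩ := hβ μ hμ (Or.symm hd) x hx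
      exact ⟨y, hy, γ, hγ.trans_le (le_max_right _ _), hxy⟩

theorem val_eq_el (hg : g ∈ ordModel.univ κ) : val g κ = el g κ := by
  rw [el, transition_self hg]

theorem ordModel_mem_iff (hg : g ∈ ordModel.univ κ) :
    ordModel.mem κ f g ↔ ∃ h ∈ el g κ, ordModel.eq κ f h := by
  rw [← val_eq_el hg]
  constructor
  · rintro ⟨α, h, hh, β, -, hβ⟩
    exact ⟨h, hh, β, hβ⟩
  · rintro ⟨h, hh, β, hβ⟩
    exact ⟨β + 1, h, hh, β, Order.lt_add_one_iff.2 le_rfl, hβ⟩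

theorem ordModel_eq_symm (h : ordModel.eq κ f g) : ordModel.eq κ g f :=
  let ⟨α, hα⟩ := h
  ⟨α, eqStage_symm hα⟩

theorem ordModel_eq_mono (hf : f ∈ ordModel.univ κ) (hg : g ∈ ordModel.univ κ) (hμ : κ ≤ μ)
    (h : ordModel.eq κ f g) : ordModel.eq μ (transition μ f) (transition μ g) := by
  rw [ordModel_eq_iff (transition_mem_univ hf hμ) (transition_mem_univ hg hμ)]
  intro ν hν
  rw [el_transition hf hμ hν, el_transition hg hμ hν]
  exact (ordModel_eq_iff hf hg).1 h ν (hμ.trans hν)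

/-- Recursion on rank through the generators; reflexivity at a later node is transported from the
node of entry. -/
theorem ordModel_eq_refl {κ : Ordinal.{u}} {f : ZFSet.{u}} (hf : f ∈ ordModel.univ κ) :
    ordModel.eq κ f f := by
  rw [ordModel_eq_iff hf hf]
  intro μ hμ
  obtain ⟨ι, ν, g, hgen, hrank⟩ := exists_isGenerated hf
  have key : ∀ x ∈ el f μ, ∃ y ∈ el f μ, ordModel.eq μ x y := by
    intro x hx
    refine ⟨x, hx, ?_⟩
    obtain ⟨i, hi, rfl⟩ := (hgen.mem_el μ hμ x).1 hx
    exact ordModel_eq_mono (hgen.mem i) (hgen.mem i) hi (ordModel_eq_refl (hgen.mem i))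
  exact ⟨key, key⟩
termination_by f.rank
decreasing_by exact hrank i

/-- Induction on the stage of the first equation alone; the second needs no bound. In the backward
half the composite is formed from the `f` side and then reversed, which keeps the decreasing stage
on the first equation. -/
theorem eqStage_trans {α κ : Ordinal.{u}} {f g k : ZFSet.{u}} (hf : f ∈ ordModel.univ κ)
    (hg : g ∈ ordModel.univ κ) (hk : k ∈ ordModel.univ κ) (hfg : EqStage α κ f g)
    (hgk : ordModel.eq κ g k) : ordModel.eq κ f k := by
  rw [ordModel_eq_iff hg hk] at hgk
  rw [ordModel_eq_iff hf hk]
  refine fun μ hμ => ⟨fun x hx => ?_, fun z hz => ?_⟩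
  · obtain ⟨y, hy, β, hβ, hxy⟩ := eqStage_extend hf hg hfg hμ x hx
    obtain ⟨z, hz, hyz⟩ := (hgk μ hμ).1 y hy
    exact ⟨z, hz, eqStage_trans (mem_univ_of_mem_el hf hμ hx) (mem_univ_of_mem_el hg hμ hy)
      (mem_univ_of_mem_el hk hμ hz) hxy hyz⟩
  · obtain ⟨y, hy, hzy⟩ := (hgk μ hμ).2 z hz
    obtain ⟨x, hx, β, hβ, hyx⟩ := eqStage_extend hg hf (eqStage_symm hfg) hμ y hy
    exact ⟨x, hx, ordModel_eq_symm (eqStage_trans (mem_univ_of_mem_el hf hμ hx)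
      (mem_univ_of_mem_el hg hμ hy) (mem_univ_of_mem_el hk hμ hz) (eqStage_symm hyx)
      (ordModel_eq_symm hzy))⟩
termination_by α

theorem ordModel_eq_trans {k : ZFSet.{u}} (hf : f ∈ ordModel.univ κ)
    (hg : g ∈ ordModel.univ κ) (hk : k ∈ ordModel.univ κ) (hfg : ordModel.eq κ f g)
    (hgk : ordModel.eq κ g k) : ordModel.eq κ f k :=
  let ⟨_, hα⟩ := hfg
  eqStage_trans hf hg hk hα hgk

theorem ordModel_isKripkeModel : ordModel.{u}.IsKripkeModel where
  nonempty κ := by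
    obtain ⟨f, hf, -⟩ := exists_of_family (κ := κ) (ι := PEmpty.{1}) PEmpty.elim PEmpty.elim
      (fun i => i.elim) (fun i => i.elim)
    exact ⟨f, hf⟩
  trans_mem _ _ h _ hx := transition_mem_univ hx h
  trans_self _ _ hx := transition_self hx
  trans_trans _ _ _ h h' _ hx := transition_transition hx h h'
  mem_mono κ μ h x hx y hy hxy := by
    obtain ⟨z, hz, hxz⟩ := (ordModel_mem_iff hy).1 hxy
    refine (ordModel_mem_iff (transition_mem_univ hy h)).2 ⟨transition μ z, ?_,
      ordModel_eq_mono hx (mem_univ_of_mem_el hy le_rfl hz) h hxz⟩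
    rw [el_transition hy h le_rfl]
    exact transition_mem_el hy le_rfl h hz
  eq_mono _ _ h _ hx _ hy hxy := ordModel_eq_mono hx hy h hxy
  eq_refl _ _ hx := ordModel_eq_refl hx
  eq_symm _ _ _ _ _ h := ordModel_eq_symm h
  eq_trans _ _ hx _ hy _ hz h h' := ordModel_eq_trans hx hy hz h h'
  mem_congr_left κ x hx y hy z hz hxy hxz := by
    obtain ⟨w, hw, hxw⟩ := (ordModel_mem_iff hz).1 hxz
    exact (ordModel_mem_iff hz).2 ⟨w, hw, ordModel_eq_trans hy hx
      (mem_univ_of_mem_el hz le_rfl hw) (ordModel_eq_symm hxy) hxw⟩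
  mem_congr_right κ x hx y hy z hz hxy hzx := by
    obtain ⟨w, hw, hzw⟩ := (ordModel_mem_iff hx).1 hzx
    obtain ⟨w', hw', hww'⟩ := ((ordModel_eq_iff hx hy).1 hxy κ le_rfl).1 w hw
    exact (ordModel_mem_iff hy).2 ⟨w', hw', ordModel_eq_trans hz
      (mem_univ_of_mem_el hx le_rfl hw) (mem_univ_of_mem_el hy le_rfl hw') hzw hww'⟩

end

/-! ### Forced membership and equality in terms of generators. -/

open KripkeStructure Fml

section Axioms

variable {κ μ : Ordinal.{u}} {f g x y : ZFSet.{u}}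

/-- The working description of membership: up to `=`, the members at `μ` are the generators that
have entered by then. -/
theorem mem_transition_iff {ι : Type*} {ν : ι → Ordinal.{u}} {k : ι → ZFSet.{u}}
    (hf : f ∈ ordModel.univ κ) (hgen : IsGenerated κ f ν k) (hμ : κ ≤ μ) :
    ordModel.mem μ x (transition μ f) ↔ ∃ i, ν i ≤ μ ∧ ordModel.eq μ x (transition μ (k i)) := by
  rw [ordModel_mem_iff (transition_mem_univ hf hμ), el_transition hf hμ le_rfl]
  constructor
  · rintro ⟨h, hh, hxh⟩
    obtain ⟨i, hi, rfl⟩ := (hgen.mem_el μ hμ h).1 hh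
    exact ⟨i, hi, hxh⟩
  · rintro ⟨i, hi, hx⟩
    exact ⟨_, (hgen.mem_el μ hμ _).2 ⟨i, hi, rfl⟩, hx⟩

theorem mem_transition_of_isGenerated {ι : Type*} {ν : ι → Ordinal.{u}} {k : ι → ZFSet.{u}}
    (hf : f ∈ ordModel.univ κ) (hgen : IsGenerated κ f ν k) (hμ : κ ≤ μ) {i : ι} (hi : ν i ≤ μ) :
    ordModel.mem μ (transition μ (k i)) (transition μ f) :=
  (mem_transition_iff hf hgen hμ).2
    ⟨i, hi, ordModel_eq_refl (transition_mem_univ (hgen.mem i) hi)⟩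

/-- Passes from literal members, as in `ordModel_eq_iff`, to forced membership. This is the content
of Extensionality. -/
theorem eq_iff_forall_mem (hf : f ∈ ordModel.univ κ) (hg : g ∈ ordModel.univ κ) :
    ordModel.eq κ f g ↔ ∀ μ, κ ≤ μ → ∀ x ∈ ordModel.univ μ,
      (ordModel.mem μ x (transition μ f) ↔ ordModel.mem μ x (transition μ g)) := by
  constructor
  · intro h μ hμ x hx
    have h' := ordModel_eq_mono hf hg hμ h
    have hf' := transition_mem_univ hf hμ
    have hg' := transition_mem_univ hg hμ
    exact ⟨ordModel_isKripkeModel.mem_congr_right μ _ hf' _ hg' x hx h',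
      ordModel_isKripkeModel.mem_congr_right μ _ hg' _ hf' x hx (ordModel_eq_symm h')⟩
  · intro h
    rw [ordModel_eq_iff hf hg]
    have mem_self : ∀ {k μ x}, k ∈ ordModel.univ κ → κ ≤ μ → x ∈ el k μ →
        ordModel.mem μ x (transition μ k) := by
      intro k μ x hk hμ hx
      rw [ordModel_mem_iff (transition_mem_univ hk hμ), el_transition hk hμ le_rfl]
      exact ⟨x, hx, ordModel_eq_refl (mem_univ_of_mem_el hk hμ hx)⟩
    refine fun μ hμ => ⟨fun x hx => ?_, fun x hx => ?_⟩
    · have := (h μ hμ x (mem_univ_of_mem_el hf hμ hx)).1 (mem_self hf hμ hx)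
      rwa [ordModel_mem_iff (transition_mem_univ hg hμ), el_transition hg hμ le_rfl] at this
    · have := (h μ hμ x (mem_univ_of_mem_el hg hμ hx)).2 (mem_self hg hμ hx)
      rwa [ordModel_mem_iff (transition_mem_univ hf hμ), el_transition hf hμ le_rfl] at this

/-- `κ ⊨ x = ∅` -/
def EmptyAt (κ : Ordinal.{u}) (x : ZFSet.{u}) : Prop :=
  ∀ μ, κ ≤ μ → ∀ z ∈ ordModel.univ μ, ¬ ordModel.mem μ z (transition μ x)

/-- `κ ⊨ y = x ∪ {x}` -/
def SuccAt (κ : Ordinal.{u}) (y x : ZFSet.{u}) : Prop :=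
  ∀ μ, κ ≤ μ → ∀ z ∈ ordModel.univ μ, (ordModel.mem μ z (transition μ y) ↔
    ordModel.mem μ z (transition μ x) ∨ ordModel.eq μ z (transition μ x))

theorem EmptyAt.mono (hx : x ∈ ordModel.univ κ) (h : EmptyAt κ x) (hμ : κ ≤ μ) :
    EmptyAt μ (transition μ x) := by
  intro ν hν z hz
  rw [transition_transition hx hμ hν]
  exact h ν (hμ.trans hν) z hz

theorem EmptyAt.eq (hx : x ∈ ordModel.univ κ) (hy : y ∈ ordModel.univ κ) (h : EmptyAt κ x)
    (h' : EmptyAt κ y) : ordModel.eq κ x y :=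
  (eq_iff_forall_mem hx hy).2 fun μ hμ z hz => iff_of_false (h μ hμ z hz) (h' μ hμ z hz)

theorem EmptyAt.congr (hx : x ∈ ordModel.univ κ) (hy : y ∈ ordModel.univ κ)
    (hxy : ordModel.eq κ x y) (h : EmptyAt κ x) : EmptyAt κ y :=
  fun μ hμ z hz hzy => h μ hμ z hz (((eq_iff_forall_mem hx hy).1 hxy μ hμ z hz).2 hzy)

theorem SuccAt.mono (hx : x ∈ ordModel.univ κ) (hy : y ∈ ordModel.univ κ) (h : SuccAt κ y x)
    (hμ : κ ≤ μ) : SuccAt μ (transition μ y) (transition μ x) := by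
  intro ν hν z hz
  rw [transition_transition hx hμ hν, transition_transition hy hμ hν]
  exact h ν (hμ.trans hν) z hz

theorem SuccAt.eq (hx : x ∈ ordModel.univ κ) (hy : y ∈ ordModel.univ κ) (h : SuccAt κ x f)
    (h' : SuccAt κ y f) : ordModel.eq κ x y :=
  (eq_iff_forall_mem hx hy).2 fun μ hμ z hz => (h μ hμ z hz).trans (h' μ hμ z hz).symm

theorem SuccAt.congr (hx : x ∈ ordModel.univ κ) (hy : y ∈ ordModel.univ κ)
    (hxy : ordModel.eq κ x y) (h : SuccAt κ f x) : SuccAt κ f y := by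
  intro μ hμ z hz
  have hx' := transition_mem_univ hx hμ
  have hy' := transition_mem_univ hy hμ
  have hxy' := ordModel_eq_mono hx hy hμ hxy
  rw [h μ hμ z hz, (eq_iff_forall_mem hx hy).1 hxy μ hμ z hz]
  exact or_congr_right ⟨fun h => ordModel_eq_trans hz hx' hy' h hxy',
    fun h => ordModel_eq_trans hz hy' hx' h (ordModel_eq_symm hxy')⟩

theorem exists_emptyAt (κ : Ordinal.{u}) : ∃ f ∈ ordModel.univ κ, EmptyAt κ f := by
  obtain ⟨f, hf, hgen⟩ := exists_of_family (κ := κ) (ι := PEmpty.{1}) PEmpty.elim PEmpty.elim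
    (fun i => i.elim) (fun i => i.elim)
  refine ⟨f, hf, fun μ hμ z hz h => ?_⟩
  obtain ⟨i, -⟩ := (mem_transition_iff hf hgen hμ).1 h
  exact i.elim

theorem exists_succAt (hf : f ∈ ordModel.univ κ) : ∃ g ∈ ordModel.univ κ, SuccAt κ g f := by
  obtain ⟨ι, ν, k, hgen, -⟩ := exists_isGenerated hf
  -- The generators of `f`, together with `f` itself entering at `κ` (the index `none`).
  obtain ⟨g, hg, hgen'⟩ := exists_of_family (κ := κ) (fun o : Option ι => o.elim κ ν)
    (fun o => o.elim f k) (fun o => by cases o <;> simp [hgen.le])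
    (fun o => by cases o with | none => exact hf | some i => exact hgen.mem i)
  refine ⟨g, hg, fun μ hμ z hz => ?_⟩
  rw [mem_transition_iff hg hgen' hμ, mem_transition_iff hf hgen hμ, Option.exists]
  simp only [Option.elim_none, Option.elim_some, hμ, true_and]
  exact or_comm

/-! ### The meaning in the model of the formulas used by the axioms. -/

variable {s : ℕ → ZFSet.{u}}

theorem forces_isEmpty (hs : ∀ n, s n ∈ ordModel.univ κ) {i : ℕ} :
    ordModel.Forces κ s (isEmpty i) ↔ EmptyAt κ (s i) :=
  ordModel_isKripkeModel.forces_all_imp hs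

theorem forces_isSingletonEmpty (hs : ∀ n, s n ∈ ordModel.univ κ) {i : ℕ} :
    ordModel.Forces κ s (isSingletonEmpty i) ↔ ∀ μ, κ ≤ μ → ∀ x ∈ ordModel.univ μ,
      (ordModel.mem μ x (transition μ (s i)) ↔ EmptyAt μ x) := by
  refine (ordModel_isKripkeModel.forces_all_iff hs).trans ?_
  refine forall₂_congr fun μ hμ => forall₂_congr fun x hx => ?_
  rw [forces_isEmpty (push_mem hx (ordModel_isKripkeModel.trans_assignment_mem hμ hs))]
  rfl

theorem forces_isSubset (hs : ∀ n, s n ∈ ordModel.univ κ) {i j : ℕ} :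
    ordModel.Forces κ s (isSubset i j) ↔ ∀ μ, κ ≤ μ → ∀ x ∈ ordModel.univ μ,
      ordModel.mem μ x (transition μ (s i)) → ordModel.mem μ x (transition μ (s j)) :=
  ordModel_isKripkeModel.forces_all_imp hs

theorem forces_isSucc (hs : ∀ n, s n ∈ ordModel.univ κ) {i j : ℕ} :
    ordModel.Forces κ s (isSucc i j) ↔ SuccAt κ (s i) (s j) :=
  ordModel_isKripkeModel.forces_all_iff hs

theorem forces_isInductive (hs : ∀ n, s n ∈ ordModel.univ κ) {i : ℕ} :
    ordModel.Forces κ s (isInductive i) ↔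
      (∃ x ∈ ordModel.univ κ, ordModel.mem κ x (s i) ∧ EmptyAt κ x) ∧
      ∀ μ, κ ≤ μ → ∀ x ∈ ordModel.univ μ, ordModel.mem μ x (transition μ (s i)) →
        ∃ y ∈ ordModel.univ μ, ordModel.mem μ y (transition μ (s i)) ∧ SuccAt μ y x := by
  refine and_congr (exists_congr fun x => and_congr_right fun hx => and_congr_right fun _ => ?_)
    ((ordModel_isKripkeModel.forces_all_imp hs).trans ?_)
  · exact forces_isEmpty (push_mem hx hs)
  · refine forall₂_congr fun μ hμ => forall₂_congr fun x hx => imp_congr Iff.rfl ?_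
    refine exists_congr fun y => and_congr_right fun hy => and_congr_right fun _ => ?_
    exact forces_isSucc (push_mem hy (push_mem hx
      (ordModel_isKripkeModel.trans_assignment_mem hμ hs)))

/-! ### The axioms, one by one. -/

theorem models_axEmpty : ordModel.{u}.Models axEmpty := by
  intro κ s hs
  obtain ⟨f, hf, hf'⟩ := exists_emptyAt κ
  exact ⟨f, hf, (forces_isEmpty (push_mem hf hs)).2 hf'⟩

theorem models_axExt : ordModel.{u}.Models axExt := by
  refine ordModel_isKripkeModel.models_all fun κ s hs x hx => ?_
  have hs' := push_mem hx hs
  refine (ordModel_isKripkeModel.forces_all_iff hs').2 fun μ hμ y hy => ?_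
  have hs'' := push_mem hy (ordModel_isKripkeModel.trans_assignment_mem hμ hs')
  exact (eq_iff_forall_mem (transition_mem_univ hx hμ) hy).trans
    (ordModel_isKripkeModel.forces_all_iff (φ := .mem 0 2) (ψ := .mem 0 1) hs'').symm

theorem models_axPair : ordModel.{u}.Models axPair := by
  refine ordModel_isKripkeModel.models_all fun κ s hs a ha => ?_
  -- The set `a` is absorbed into the assignment; from here on `s 0` plays its role.
  refine ordModel_isKripkeModel.models_all (φ := .ex _) (fun κ s hs b hb => ?_) κ _
    (push_mem ha hs)
  have ha := hs 0
  obtain ⟨c, hc, hgen⟩ := exists_of_family (κ := κ) (fun _ : Bool => κ) (fun i => cond i (s 0) b)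
    (fun _ => le_rfl) (fun i => by cases i <;> simp [ha, hb])
  refine ⟨c, hc, (ordModel_isKripkeModel.forces_all_iff
    (push_mem hc (push_mem hb hs))).2 fun μ hμ x hx => ?_⟩
  refine (mem_transition_iff hc hgen hμ).trans ?_
  rw [Bool.exists_bool]
  exact ⟨fun h => h.symm.imp And.right And.right,
    fun h => h.symm.imp (fun h => ⟨hμ, h⟩) fun h => ⟨hμ, h⟩⟩

theorem models_axUnion : ordModel.{u}.Models axUnion := by
  refine ordModel_isKripkeModel.models_all fun κ s hs a ha => ?_
  obtain ⟨ι, ν, g, hgen, -⟩ := exists_isGenerated ha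
  -- The union is generated by the generators of the generators, at their own nodes of entry.
  choose ι' ν' g' hgen' _ using fun i => exists_isGenerated (hgen.mem i)
  obtain ⟨c, hc, hgenc⟩ := exists_of_family (κ := κ) (fun i : Σ i, ι' i => ν' i.1 i.2)
    (fun i => g' i.1 i.2) (fun i => (hgen.le i.1).trans ((hgen' i.1).le i.2))
    (fun i => (hgen' i.1).mem i.2)
  refine ⟨c, hc, (ordModel_isKripkeModel.forces_all_iff
    (push_mem hc (push_mem ha hs))).2 fun μ hμ x hx => ?_⟩
  refine (mem_transition_iff hc hgenc hμ).trans ?_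
  change _ ↔ ∃ y ∈ ordModel.univ μ, ordModel.mem μ y (transition μ a) ∧ ordModel.mem μ x y
  constructor
  · rintro ⟨⟨i, j⟩, hj, hx⟩
    have hi := ((hgen' i).le j).trans hj
    exact ⟨_, transition_mem_univ (hgen.mem i) hi, mem_transition_of_isGenerated ha hgen hμ hi,
      (mem_transition_iff (hgen.mem i) (hgen' i) hi).2 ⟨j, hj, hx⟩⟩
  · rintro ⟨y, hy, hya, hxy⟩
    obtain ⟨i, hi, hyi⟩ := (mem_transition_iff ha hgen hμ).1 hya
    have := ordModel_isKripkeModel.mem_congr_right μ y hy _ (transition_mem_univ (hgen.mem i) hi)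
      x hx hyi hxy
    obtain ⟨j, hj, hxj⟩ := (mem_transition_iff (hgen.mem i) (hgen' i) hi).1 this
    exact ⟨⟨i, j⟩, hj, hxj⟩

theorem models_axStrongInfinity : ordModel.{u}.Models axStrongInfinity := by
  intro κ s hs
  obtain ⟨e, he, he'⟩ := exists_emptyAt κ
  choose S hS hS' using fun x : {x // x ∈ ordModel.univ κ} => exists_succAt x.2
  -- The numerals all enter at `κ`. That every inductive set contains them is then an external
  -- induction on `n`.
  let num : ℕ → {x // x ∈ ordModel.univ κ} :=
    fun n => Nat.rec ⟨e, he⟩ (fun _ x => ⟨S x, hS x⟩) n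
  obtain ⟨w, hw, hgen⟩ := exists_of_family (κ := κ) (fun _ : ℕ => κ) (fun n => (num n).1)
    (fun _ => le_rfl) (fun n => (num n).2)
  have hs' := push_mem hw hs
  refine ⟨w, hw, (forces_isInductive hs').2 ⟨⟨e, he, ?_, he'⟩, fun μ hμ x hx hxw => ?_⟩,
    (ordModel_isKripkeModel.forces_all_imp hs').2 fun μ hμ b hb hind => ?_⟩
  · have := mem_transition_of_isGenerated hw hgen le_rfl (i := 0) le_rfl
    rwa [transition_self hw, transition_self (num 0).2] at this
  · obtain ⟨n, -, hxn⟩ := (mem_transition_iff hw hgen hμ).1 hxw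
    exact ⟨_, transition_mem_univ (num (n + 1)).2 hμ,
      mem_transition_of_isGenerated hw hgen hμ (i := n + 1) hμ,
      (SuccAt.mono (num n).2 (num (n + 1)).2 (hS' (num n)) hμ).congr
        (transition_mem_univ (num n).2 hμ) hx (ordModel_eq_symm hxn)⟩
  · have hs'' := push_mem hb (ordModel_isKripkeModel.trans_assignment_mem hμ hs')
    obtain ⟨⟨z, hz, hzb, hz'⟩, hsucc⟩ := (forces_isInductive hs'').1 hind
    change ordModel.mem μ z b at hzb
    have key : ∀ n, ordModel.mem μ (transition μ (num n).1) b := by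
      intro n
      induction n with
      | zero =>
        exact ordModel_isKripkeModel.mem_congr_left μ z hz _ (transition_mem_univ he hμ) b hb
          (hz'.eq hz (transition_mem_univ he hμ) (he'.mono he hμ)) hzb
      | succ n ih =>
        have hn := transition_mem_univ (num n).2 hμ
        have hn' := transition_mem_univ (num (n + 1)).2 hμ
        obtain ⟨y, hy, hyb, hy'⟩ := hsucc μ le_rfl _ hn (by
          change ordModel.mem μ _ (transition μ b)
          rwa [transition_self hb])
        change ordModel.mem μ y (transition μ b) at hyb
        rw [transition_self hb] at hyb
        exact ordModel_isKripkeModel.mem_congr_left μ y hy _ hn' b hb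
          (hy'.eq hy hn' ((hS' (num n)).mono (num n).2 (num (n + 1)).2 hμ)) hyb
    refine (forces_isSubset hs'').2 fun ν hν x hx hxw => ?_
    change ordModel.mem ν x (transition ν (transition μ w)) at hxw
    change ordModel.mem ν x (transition ν b)
    rw [transition_transition hw hμ hν, mem_transition_iff hw hgen (hμ.trans hν)] at hxw
    obtain ⟨n, -, hxn⟩ := hxw
    have := ordModel_isKripkeModel.mem_mono μ ν hν _ (transition_mem_univ (num n).2 hμ) b hb
      (key n)
    change ordModel.mem ν (transition ν (transition μ (num n).1)) (transition ν b) at this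
    rw [transition_transition (num n).2 hμ hν] at this
    exact ordModel_isKripkeModel.mem_congr_left ν _
      (transition_mem_univ (num n).2 (hμ.trans hν)) x hx _ (transition_mem_univ hb hν)
      (ordModel_eq_symm hxn) this

theorem models_axInfinity : ordModel.{u}.Models axInfinity := by
  intro κ s hs
  obtain ⟨w, hw, h, -⟩ := models_axStrongInfinity κ s hs
  exact ⟨w, hw, h⟩

/-- Induction on rank, for all nodes at once. A member of `x` at a later node equals the image of a
generator of smaller rank; the induction hypothesis applies to the generator at its entry node and
is transferred. -/
theorem models_axSetInd (φ : Fml) : ordModel.{u}.Models (axSetInd φ) := by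
  refine ordModel_isKripkeModel.models_imp fun κ s hs h => ?_
  have h := (ordModel_isKripkeModel.forces_all_imp hs).1 h
  suffices ∀ ρ : Ordinal.{u}, ∀ x : ZFSet.{u}, x.rank = ρ → ∀ μ, κ ≤ μ → x ∈ ordModel.univ μ →
      ordModel.Forces μ (push x fun n => ordModel.trans κ μ (s n)) φ from
    fun μ hμ x hx => this _ x rfl μ hμ hx
  intro ρ
  induction ρ using WellFoundedLT.induction with
  | ind ρ ih =>
    rintro x rfl μ hμ hx
    have hsμ := ordModel_isKripkeModel.trans_assignment_mem hμ hs
    refine h μ hμ x hx ((ordModel_isKripkeModel.forces_all_imp (push_mem hx hsμ)).2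
      fun ν hν y hy hyx => ?_)
    obtain ⟨ι, ξ, g, hgen, hrank⟩ := exists_isGenerated hx
    obtain ⟨i, hi, hyi⟩ := (mem_transition_iff hx hgen hν).1 hyx
    have hκ := hμ.trans (hgen.le i)
    have hi' := ih _ (hrank i) (g i) rfl (ξ i) hκ (hgen.mem i)
    refine (forces_rename φ _ ν _).2 ?_
    rw [show (fun n => push y (fun n => ordModel.trans μ ν
        (push x (fun n => ordModel.trans κ μ (s n)) n)) (if n = 0 then 0 else n + 1)) =
        push y fun n => ordModel.trans κ ν (s n) from funext fun n => by
      cases n with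
      | zero => rfl
      | succ n => exact ordModel_isKripkeModel.trans_trans κ μ ν hμ hν _ (hs n)]
    exact ordModel_isKripkeModel.forces_transfer hi
      (push_mem (hgen.mem i) (ordModel_isKripkeModel.trans_assignment_mem hκ hs))
      (push_mem hy (ordModel_isKripkeModel.trans_assignment_mem (hμ.trans hν) hs))
      (eq_trans_push (ordModel_eq_symm hyi)
        fun n => ordModel_isKripkeModel.eq_trans_trans hκ hi (hs n)) hi'

theorem models_axSep (φ : Fml) : ordModel.{u}.Models (axSep φ) := by
  refine ordModel_isKripkeModel.models_all fun κ s hs a ha => ?_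
  have hA := push_mem ha hs
  have hAμ := fun μ (hμ : κ ≤ μ) => ordModel_isKripkeModel.trans_assignment_mem hμ hA
  generalize hAdef : push a s = A at hA hAμ ⊢
  obtain ⟨ι, ν, g, hgen, -⟩ := exists_isGenerated ha
  -- The nodes at which the `i`-th generator is present and satisfies `φ`. By persistence they form
  -- a final segment, whose least element is the new entry node; generators that never satisfy `φ`
  -- are dropped.
  let N : ι → Set Ordinal.{u} := fun i => {μ | ν i ≤ μ ∧ ordModel.Forces μ
    (push (transition μ (g i)) fun n => ordModel.trans κ μ (A n)) φ}
  have hN : ∀ i : {i // (N i).Nonempty}, sInf (N i.1) ∈ N i.1 := fun i => csInf_mem i.2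
  obtain ⟨b, hb, hgenb⟩ := exists_of_family (κ := κ)
    (fun i : {i // (N i).Nonempty} => sInf (N i.1)) (fun i => transition (sInf (N i.1)) (g i.1))
    (fun i => (hgen.le i).trans (hN i).1) (fun i => transition_mem_univ (hgen.mem i) (hN i).1)
  refine ⟨b, hb, (ordModel_isKripkeModel.forces_all_iff (push_mem hb hA)).2
    fun μ hμ x hx => ?_⟩
  refine (mem_transition_iff hb hgenb hμ).trans (Iff.trans ?_ (and_congr
    (a := ordModel.mem μ x (transition μ a))
    (b := ordModel.Forces μ (push x fun n => ordModel.trans κ μ (A n)) φ)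
    (by subst hAdef; exact Iff.rfl) ?_))
  · rw [mem_transition_iff ha hgen hμ]
    constructor
    · rintro ⟨i, hi, hxi⟩
      obtain ⟨hνi, hfi⟩ := hN i
      rw [transition_transition (hgen.mem i) hνi hi] at hxi
      refine ⟨⟨i, hνi.trans hi, hxi⟩, ?_⟩
      refine ordModel_isKripkeModel.forces_transfer hi
        (push_mem (transition_mem_univ (hgen.mem i) hνi) (hAμ _ ((hgen.le i).trans hνi)))
        (push_mem hx (hAμ μ hμ)) (eq_trans_push ?_ fun n =>
          ordModel_isKripkeModel.eq_trans_trans ((hgen.le i).trans hνi) hi (hA n)) hfi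
      change ordModel.eq μ (transition μ (transition _ _)) x
      rw [transition_transition (hgen.mem i) hνi hi]
      exact ordModel_eq_symm hxi
    · rintro ⟨⟨i, hi, hxi⟩, hf⟩
      have hμN : μ ∈ N i := ⟨hi, (ordModel_isKripkeModel.forces_push_congr hx
        (transition_mem_univ (hgen.mem i) hi) (hAμ μ hμ) hxi).1 hf⟩
      have hle : sInf (N i) ≤ μ := csInf_le' hμN
      refine ⟨⟨i, μ, hμN⟩, hle, ?_⟩
      dsimp only
      rwa [transition_transition (hgen.mem i) (hN ⟨i, μ, hμN⟩).1 hle]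
  · refine Iff.trans ?_ (forces_rename φ _ μ _).symm
    exact Iff.of_eq (congrArg (fun t => ordModel.Forces μ t φ)
      (funext fun n => by cases n <;> rfl))

theorem models_axStrongColl (φ : Fml) : ordModel.{u}.Models (axStrongColl φ) := by
  intro κ₀ s₀ hs₀
  refine (ordModel_isKripkeModel.forces_all_imp hs₀).2 fun κ hκ a ha h => ?_
  have hA := push_mem ha (ordModel_isKripkeModel.trans_assignment_mem hκ hs₀)
  have hAμ := fun μ (hμ : κ ≤ μ) => ordModel_isKripkeModel.trans_assignment_mem hμ hA
  have h : ∀ μ, κ ≤ μ → ∀ x ∈ ordModel.univ μ, ordModel.mem μ x (transition μ a) →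
    ∃ y ∈ ordModel.univ μ, ordModel.Forces μ (push y (push x fun n => ordModel.trans κ μ
      (push a (fun n => ordModel.trans κ₀ κ (s₀ n)) n))) φ :=
    (ordModel_isKripkeModel.forces_all_imp hA).1 h
  generalize hAdef : (push a fun n => ordModel.trans κ₀ κ (s₀ n)) = A at hA hAμ h ⊢
  obtain ⟨ι, ν, g, hgen, -⟩ := exists_isGenerated ha
  -- One witness per generator, chosen at the node where that generator enters; the witness enters
  -- the collecting set at the same node.
  choose y hy hyφ using fun i => h (ν i) (hgen.le i) (g i) (hgen.mem i) (by
    have := mem_transition_of_isGenerated ha hgen (hgen.le i) (i := i) le_rfl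
    rwa [transition_self (hgen.mem i)] at this)
  obtain ⟨b, hb, hgenb⟩ := exists_of_family (κ := κ) ν y hgen.le hy
  -- Both halves of the conclusion use this: the pair of a generator and its witness satisfies `φ`
  -- from its entry onward.
  have key : ∀ i μ, ν i ≤ μ → ∀ x ∈ ordModel.univ μ, ∀ z ∈ ordModel.univ μ,
      ordModel.eq μ x (transition μ (g i)) → ordModel.eq μ z (transition μ (y i)) →
      ordModel.Forces μ (push z (push x fun n => ordModel.trans κ μ (A n))) φ := by
    intro i μ hi x hx z hz hxi hzi
    exact ordModel_isKripkeModel.forces_transfer hi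
      (push_mem (hy i) (push_mem (hgen.mem i) (hAμ _ (hgen.le i))))
      (push_mem hz (push_mem hx (hAμ μ ((hgen.le i).trans hi))))
      (eq_trans_push (ordModel_eq_symm hzi) (eq_trans_push (ordModel_eq_symm hxi) fun n =>
        ordModel_isKripkeModel.eq_trans_trans (hgen.le i) hi (hA n))) (hyφ i)
  refine ⟨b, hb, (ordModel_isKripkeModel.forces_all_imp (push_mem hb hA)).2
    fun μ hμ x hx hxa => ?_, (ordModel_isKripkeModel.forces_all_imp (push_mem hb hA)).2
    fun μ hμ z hz hzb => ?_⟩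
  · replace hxa : ordModel.mem μ x (transition μ a) := by subst hAdef; exact hxa
    obtain ⟨i, hi, hxi⟩ := (mem_transition_iff ha hgen hμ).1 hxa
    have hyi := transition_mem_univ (hy i) hi
    refine ⟨_, hyi, mem_transition_of_isGenerated hb hgenb hμ hi,
      (forces_rename φ _ μ _).2 ?_⟩
    convert key i μ hi x hx _ hyi hxi (ordModel_eq_refl hyi) using 1
    funext n
    match n with
    | 0 => rfl
    | 1 => rfl
    | n + 2 => rfl
  · obtain ⟨i, hi, hzi⟩ := (mem_transition_iff hb hgenb hμ).1 hzb
    have hgi := transition_mem_univ (hgen.mem i) hi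
    refine ⟨_, hgi, ?_, (forces_rename φ _ μ _).2 ?_⟩
    · subst hAdef
      exact mem_transition_of_isGenerated ha hgen hμ hi
    · convert key i μ hi _ hgi z hz (ordModel_eq_refl hgi) hzi using 1
      funext n
      match n with
      | 0 => rfl
      | 1 => rfl
      | n + 2 => rfl

theorem models_axColl (φ : Fml) : ordModel.{u}.Models (axColl φ) := by
  intro κ s hs
  refine (ordModel_isKripkeModel.forces_all_imp hs).2 fun μ hμ a ha h => ?_
  obtain ⟨b, hb, h', -⟩ :=
    (ordModel_isKripkeModel.forces_all_imp hs).1 (models_axStrongColl φ κ s hs) μ hμ a ha h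
  exact ⟨b, hb, h'⟩

theorem models_axSubsetColl (φ : Fml) : ordModel.{u}.Models (axSubsetColl φ) := by
  refine ordModel_isKripkeModel.models_all fun κ s hs a ha => ?_
  refine ordModel_isKripkeModel.models_all (φ := .ex _) (fun κ A hA b hb => ?_) κ _
    (push_mem ha hs)
  have ha := hA 0
  replace hA := push_mem hb hA
  have hAμ := fun μ (hμ : κ ≤ μ) => ordModel_isKripkeModel.trans_assignment_mem hμ hA
  obtain ⟨B, hB, hB0, hB1⟩ : ∃ B : ℕ → ZFSet.{u}, B = push b A ∧ B 0 = b ∧ B 1 = A 0 :=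
    ⟨_, rfl, rfl, rfl⟩
  rw [← hB] at hA hAμ ⊢
  rw [← hB1] at ha
  rw [← hB0] at hb
  obtain ⟨ι, ν, g, hgen, -⟩ := exists_isGenerated ha
  obtain ⟨ι', ν', g', hgen', -⟩ := exists_isGenerated hb
  -- By the node `l` all generators of `b` have entered.
  let l : Ordinal.{u} := max κ (⨆ j, ν' j + 1)
  have hl : ∀ j, ν' j ≤ l := fun j => (Ordinal.lt_iSup_add_one ν' j).le.trans (le_max_right _ _)
  -- A starting node, and a map from generators of `a` to generators of `b` whose value at `i` is
  -- present at the first node past both the start and the entry of `i`. Bounding the start by `l`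
  -- makes `J` small.
  let J := {p : Set.Iic l × (ι → ι') //
    κ ≤ p.1.1 ∧ ∀ i, ν' (p.2 i) ≤ max p.1.1 (ν i)}
  have hd := fun p : J => exists_of_family (κ := p.1.1.1) (fun i : ι => max p.1.1.1 (ν i))
    (fun i => transition (max p.1.1.1 (ν i)) (g' (p.1.2 i))) (fun _ => le_max_left _ _)
    (fun i => transition_mem_univ (hgen'.mem _) (p.2.2 i))
  choose d hd hgend using hd
  obtain ⟨c, hc, hgenc⟩ := exists_of_family (κ := κ) (fun p : J => p.1.1.1) d
    (fun p => p.2.1) hd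
  refine ⟨c, hc, (ordModel_isKripkeModel.forces_all_imp (push_mem hc hA)).2
    fun μ hμ v hv h => ?_⟩
  have hC := push_mem hv (ordModel_isKripkeModel.trans_assignment_mem hμ (push_mem hc hA))
  have hV := push_mem hv (hAμ μ hμ)
  have hVρ := fun ρ (hρ : μ ≤ ρ) => ordModel_isKripkeModel.trans_assignment_mem hρ hV
  have h' : ∀ ρ, μ ≤ ρ → ∀ x ∈ ordModel.univ ρ, ordModel.mem ρ x (transition ρ (B 1)) →
      ∃ y ∈ ordModel.univ ρ, ordModel.mem ρ y (transition ρ (B 0)) ∧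
        ordModel.Forces ρ (push y (push x fun n => ordModel.trans μ ρ
          (push v (fun n => ordModel.trans κ μ (B n)) n))) φ := by
    intro ρ hρ x hx hxa
    obtain ⟨y, hy, hyb, hf⟩ := (ordModel_isKripkeModel.forces_all_imp hC).1 h ρ hρ x hx (by
      change ordModel.mem ρ x (transition ρ (transition μ (B 1)))
      rwa [transition_transition ha hμ hρ])
    change ordModel.mem ρ y (transition ρ (transition μ (B 0))) at hyb
    rw [transition_transition hb hμ hρ] at hyb
    refine ⟨y, hy, hyb, ?_⟩
    convert (forces_rename φ _ ρ _).1 hf using 1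
    funext n
    match n with
    | 0 => rfl
    | 1 => rfl
    | 2 => rfl
    | n + 3 => rfl
  -- The hypothesis, applied to each generator of `a` at the first node where it and `v` are both
  -- present.
  have hF : ∀ i, ∃ j, ν' j ≤ max μ (ν i) ∧ ordModel.Forces (max μ (ν i))
      (push (transition (max μ (ν i)) (g' j)) (push (transition (max μ (ν i)) (g i))
        fun n => ordModel.trans μ (max μ (ν i))
          (push v (fun n => ordModel.trans κ μ (B n)) n))) φ := by
    intro i
    have hi : ν i ≤ max μ (ν i) := le_max_right _ _
    have hμi : μ ≤ max μ (ν i) := le_max_left _ _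
    have hgi := transition_mem_univ (hgen.mem i) hi
    obtain ⟨y, hy, hyb, hf⟩ := h' (max μ (ν i)) hμi _ hgi
      (mem_transition_of_isGenerated ha hgen (hμ.trans hμi) hi)
    obtain ⟨j, hj, hyj⟩ := (mem_transition_iff hb hgen' (hμ.trans hμi)).1 hyb
    exact ⟨j, hj, (ordModel_isKripkeModel.forces_push_congr hy
      (transition_mem_univ (hgen'.mem j) hj) (push_mem hgi (hVρ _ hμi)) hyj).1 hf⟩
  choose F hF hφ using hF
  have hmin : κ ≤ min μ l := le_min hμ (le_max_left _ _)
  -- The node `μ` is unbounded, so `min μ l` replaces it. If `l < μ`, the chosen generators of `b`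
  -- are already there at `l`.
  let p : J := ⟨⟨⟨min μ l, Set.mem_Iic.2 (min_le_right _ _)⟩, F⟩, hmin, fun i => by
    rw [max_min_distrib_right]
    exact le_min (hF i) ((hl _).trans (le_max_left _ _))⟩
  have hpμ : p.1.1.1 ≤ μ := min_le_left _ _
  have hdμ := transition_mem_univ (hd p) hpμ
  -- From `μ` on, the starting node has been passed and no longer affects the members of `d p`.
  have memd : ∀ ρ, μ ≤ ρ → ∀ y, ordModel.mem ρ y (transition ρ (d p)) ↔
      ∃ i, ν i ≤ ρ ∧ ordModel.eq ρ y (transition ρ (g' (F i))) := by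
    intro ρ hρ y
    rw [mem_transition_iff (hd p) (hgend p) (hpμ.trans hρ)]
    refine exists_congr fun i => ?_
    constructor
    · rintro ⟨hi, hy⟩
      rw [transition_transition (hgen'.mem _) (p.2.2 i) hi] at hy
      exact ⟨(le_max_right _ _).trans hi, hy⟩
    · rintro ⟨hi, hy⟩
      have hi' : max p.1.1.1 (ν i) ≤ ρ := max_le (hpμ.trans hρ) hi
      refine ⟨hi', ?_⟩
      rwa [transition_transition (hgen'.mem _) (p.2.2 i) hi']
  have key : ∀ i ρ, μ ≤ ρ → ν i ≤ ρ → ∀ x ∈ ordModel.univ ρ, ∀ y ∈ ordModel.univ ρ,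
      ordModel.eq ρ x (transition ρ (g i)) → ordModel.eq ρ y (transition ρ (g' (F i))) →
      ordModel.Forces ρ (push y (push x fun n => ordModel.trans μ ρ
        (push v (fun n => ordModel.trans κ μ (B n)) n))) φ := by
    intro i ρ hρ hi x hx y hy hxi hyi
    have hm : max μ (ν i) ≤ ρ := max_le hρ hi
    have hi₁ : ν i ≤ max μ (ν i) := le_max_right _ _
    refine ordModel_isKripkeModel.forces_transfer hm
      (push_mem (transition_mem_univ (hgen'.mem _) (hF i))
        (push_mem (transition_mem_univ (hgen.mem i) hi₁) (hVρ _ (le_max_left _ _))))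
      (push_mem hy (push_mem hx (hVρ ρ hρ))) (eq_trans_push ?_ (eq_trans_push ?_ fun n =>
        ordModel_isKripkeModel.eq_trans_trans (le_max_left _ _) hm (hV n))) (hφ i)
    · change ordModel.eq ρ (transition ρ (transition _ _)) y
      rw [transition_transition (hgen'.mem _) (hF i) hm]
      exact ordModel_eq_symm hyi
    · change ordModel.eq ρ (transition ρ (transition _ _)) x
      rw [transition_transition (hgen.mem i) hi₁ hm]
      exact ordModel_eq_symm hxi
  have hD := push_mem hdμ hC
  refine ⟨transition μ (d p), hdμ, mem_transition_of_isGenerated hc hgenc hμ (i := p) hpμ,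
    (ordModel_isKripkeModel.forces_all_imp hD).2 fun ρ hρ x hx hxa => ?_,
    (ordModel_isKripkeModel.forces_all_imp hD).2 fun ρ hρ y hy hyd => ?_⟩
  · change ordModel.mem ρ x (transition ρ (transition μ (B 1))) at hxa
    rw [transition_transition ha hμ hρ] at hxa
    obtain ⟨i, hi, hxi⟩ := (mem_transition_iff ha hgen (hμ.trans hρ)).1 hxa
    have hj : ν' (F i) ≤ ρ := (hF i).trans (max_le hρ hi)
    have hgj := transition_mem_univ (hgen'.mem (F i)) hj
    refine ⟨_, hgj, ?_, (forces_rename φ _ ρ _).2 ?_⟩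
    · change ordModel.mem ρ _ (transition ρ (transition μ (d p)))
      rw [transition_transition (hd p) hpμ hρ, memd ρ hρ]
      exact ⟨i, hi, ordModel_eq_refl hgj⟩
    · convert key i ρ hρ hi x hx _ hgj hxi (ordModel_eq_refl hgj) using 1
      funext n
      match n with
      | 0 => rfl
      | 1 => rfl
      | 2 => rfl
      | n + 3 => rfl
  · change ordModel.mem ρ y (transition ρ (transition μ (d p))) at hyd
    rw [transition_transition (hd p) hpμ hρ, memd ρ hρ] at hyd
    obtain ⟨i, hi, hyi⟩ := hyd
    have hgi := transition_mem_univ (hgen.mem i) hi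
    refine ⟨_, hgi, ?_, (forces_rename φ _ ρ _).2 ?_⟩
    · change ordModel.mem ρ _ (transition ρ (transition μ (B 1)))
      rw [transition_transition ha hμ hρ]
      exact mem_transition_of_isGenerated ha hgen (hμ.trans hρ) hi
    · convert key i ρ hρ hi _ hgi y hy (ordModel_eq_refl hgi) hyi using 1
      funext n
      match n with
      | 0 => rfl
      | 1 => rfl
      | 2 => rfl
      | n + 3 => rfl

theorem models_CZF {φ : Fml} (h : φ ∈ CZF) : ordModel.{u}.Models φ := by
  cases h with
  | empty => exact models_axEmpty
  | strongInfinity => exact models_axStrongInfinity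
  | pair => exact models_axPair
  | union => exact models_axUnion
  | ext => exact models_axExt
  | setInd φ => exact models_axSetInd φ
  | subsetColl φ => exact models_axSubsetColl φ
  | delta0Sep φ _ => exact models_axSep φ
  | strongColl φ => exact models_axStrongColl φ

theorem models_IZFMinusPowerSet {φ : Fml} (h : φ ∈ IZFMinusPowerSet) :
    ordModel.{u}.Models φ := by
  cases h with
  | empty => exact models_axEmpty
  | infinity => exact models_axInfinity
  | pair => exact models_axPair
  | union => exact models_axUnion
  | ext => exact models_axExt
  | setInd φ => exact models_axSetInd φ
  | sep φ => exact models_axSep φ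
  | coll φ => exact models_axColl φ

end Axioms

/-! ### The failure of Power Set and its underivability. -/

open KripkeStructure Fml

section PowerSet

variable {κ μ σ : Ordinal.{u}} {x a p : ZFSet.{u}} {s : ℕ → ZFSet.{u}}

theorem zeroAt_mem_univ (κ : Ordinal.{u}) : zeroAt κ ∈ ordModel.univ κ :=
  (graph_mem_univ_iff (Order.lt_add_one_iff.2 le_rfl)).2 fun _ _ =>
    ⟨fun g hg => (ZFSet.notMem_empty g hg).elim, fun g hg => (ZFSet.notMem_empty g hg).elim,
      fun _ _ _ g hg => (ZFSet.notMem_empty g hg).elim⟩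

theorem transition_zeroAt (hμ : κ ≤ μ) : transition μ (zeroAt κ) = zeroAt μ := by
  rcases hμ.eq_or_lt with rfl | hμ
  · exact transition_self (zeroAt_mem_univ κ)
  · rw [transition_of_notMem (by
      rw [zeroAt, dom_graph, mem_Ico_add_one]
      exact hμ.ne'), zeroAt]
    congr 1
    funext _
    ext h
    simp [ZFSet.mem_range, mem_members_graph]

theorem el_zeroAt (hμ : κ ≤ μ) : el (zeroAt κ) μ = ∅ := by
  rw [el, transition_zeroAt hμ, zeroAt, val_graph (mem_Ico_add_one.2 rfl)]

theorem emptyAt_zeroAt (κ : Ordinal.{u}) : EmptyAt κ (zeroAt κ) := by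
  intro μ hμ z hz h
  rw [transition_zeroAt hμ, ordModel_mem_iff (zeroAt_mem_univ μ), el_zeroAt le_rfl] at h
  obtain ⟨k, hk, -⟩ := h
  exact ZFSet.notMem_empty k hk

theorem oneFrom_mem_univ (κ : Ordinal.{u}) : oneFrom κ ∈ ordModel.univ 0 := by
  refine (graph_mem_univ_iff (bot_le.trans_lt (Order.lt_add_one_iff.2 le_rfl))).2 fun μ hμ => ?_
  rcases lt_or_ge μ κ with h | h
  · simp [h]
  · obtain rfl : μ = κ := le_antisymm (Order.lt_add_one_iff.1 hμ.2) h
    simp only [lt_irrefl, if_false, ZFSet.mem_singleton, forall_eq]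
    refine ⟨zeroAt_mem_univ μ, ?_, fun ν hν hμν => ?_⟩
    · rw [zeroAt, dom_graph]
      exact fun ξ hξ => ⟨bot_le, hξ.2⟩
    · rw [if_neg hμν.not_gt, ZFSet.mem_singleton]
      obtain rfl := le_antisymm hμν (Order.lt_add_one_iff.1 hν.2)
      exact transition_zeroAt le_rfl

theorem mem_el_oneFrom : x ∈ el (oneFrom κ) μ ↔ κ ≤ μ ∧ x = zeroAt μ := by
  rcases lt_or_ge κ μ with h | h
  · rw [mem_el_of_notMem (by
      rw [oneFrom, dom_graph]
      exact fun h' => (Order.lt_add_one_iff.1 h'.2).not_gt h)]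
    simp only [oneFrom, mem_members_graph]
    constructor
    · rintro ⟨g, ⟨ν, hν, hg⟩, rfl⟩
      split_ifs at hg with hνκ
      · exact (ZFSet.notMem_empty g hg).elim
      · rw [ZFSet.mem_singleton.1 hg]
        exact ⟨h.le, transition_zeroAt h.le⟩
    · rintro ⟨-, rfl⟩
      refine ⟨zeroAt κ, ⟨κ, ⟨bot_le, Order.lt_add_one_iff.2 le_rfl⟩, ?_⟩,
        (transition_zeroAt h.le).symm⟩
      rw [if_neg (lt_irrefl κ), ZFSet.mem_singleton]
  · rw [oneFrom, el_graph (κ := 0) ⟨bot_le, Order.lt_add_one_iff.2 h⟩]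
    rcases h.eq_or_lt with rfl | h
    · simp
    · simp [h, h.not_ge]

/-- Lets every computation with `1_κ` serve for `1` too. -/
theorem oneFrom_zero : oneFrom (0 : Ordinal.{u}) = kripkeOne := by
  have : ∀ μ : Ordinal.{u}, ¬ μ < 0 := fun _ => not_lt_bot
  simp [oneFrom, kripkeOne, this]

/-- The truth value of `∅ ∈ 1_κ` is the final segment of nodes from `κ` on; this supplies a proper
class of truth values. -/
theorem mem_oneFrom_iff (hx : x ∈ ordModel.univ μ) :
    ordModel.mem μ x (transition μ (oneFrom κ)) ↔ κ ≤ μ ∧ EmptyAt μ x := by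
  rw [ordModel_mem_iff (transition_mem_univ (oneFrom_mem_univ κ) bot_le),
    el_transition (oneFrom_mem_univ κ) bot_le le_rfl]
  simp only [mem_el_oneFrom]
  constructor
  · rintro ⟨_, ⟨h, rfl⟩, hx0⟩
    exact ⟨h, (emptyAt_zeroAt μ).congr (zeroAt_mem_univ μ) hx (ordModel_eq_symm hx0)⟩
  · rintro ⟨h, hx0⟩
    exact ⟨_, ⟨h, rfl⟩, hx0.eq hx (zeroAt_mem_univ μ) (emptyAt_zeroAt μ)⟩

/-- No Kripke set contains all the `1_κ`: two of them that enter at different nodes are different,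
while the members of a Kripke set at a given node are only set-many. -/
theorem exists_oneFrom_notMem (hp : p ∈ ordModel.univ σ) :
    ∃ κ, ¬ ordModel.mem σ (transition σ (oneFrom κ)) p := by
  have : Small.{u} {k // k ∈ el p σ} := ZFSet.small_coe _
  let N : ZFSet.{u} → Set Ordinal.{u} := fun k => {μ | σ ≤ μ ∧ ∃ z, z ∈ el k μ}
  -- The first node at which `k` is inhabited. For `k` never inhabited this is the default `0`,
  -- which is harmless: a member equal to `1_κ` is inhabited at `κ`.
  let m : {k // k ∈ el p σ} → Ordinal.{u} := fun k => sInf (N k.1)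
  refine ⟨max σ (⨆ k, m k + 1), fun h => ?_⟩
  set κ := max σ (⨆ k, m k + 1)
  obtain ⟨k, hk, hκk⟩ := (ordModel_mem_iff hp).1 h
  have hσκ : σ ≤ κ := le_max_left _ _
  have hmκ : m ⟨k, hk⟩ < κ := (Ordinal.lt_iSup_add_one m ⟨k, hk⟩).trans_le (le_max_right _ _)
  rw [ordModel_eq_iff (transition_mem_univ (oneFrom_mem_univ κ) bot_le)
    (mem_univ_of_mem_el hp le_rfl hk)] at hκk
  obtain ⟨z, hz, -⟩ := (hκk κ hσκ).1 (zeroAt κ) (by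
    rw [el_transition (oneFrom_mem_univ κ) bot_le hσκ, mem_el_oneFrom]
    exact ⟨le_rfl, rfl⟩)
  have hm : m ⟨k, hk⟩ ∈ N k := csInf_mem ⟨κ, hσκ, z, hz⟩
  obtain ⟨hσm, y, hy⟩ := hm
  -- A member of `k` at its first inhabited node would make `1_κ` inhabited there, before `κ`.
  obtain ⟨w, hw, -⟩ := (hκk _ hσm).2 y hy
  rw [el_transition (oneFrom_mem_univ κ) bot_le hσm, mem_el_oneFrom] at hw
  exact hw.1.not_gt hmκ

/-- Every `1_ξ`, moved to `κ`, has only empty members and so is a subset of any `{∅}`. -/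
theorem not_forces_hasPowerSet (hs : ∀ n, s n ∈ ordModel.univ κ)
    (h : ordModel.Forces κ s (isSingletonEmpty 0)) : ¬ ordModel.Forces κ s (hasPowerSet 0) := by
  rintro ⟨p, hp, hpow⟩
  have hpow := (ordModel_isKripkeModel.forces_all_imp (push_mem hp hs)).1 hpow
  obtain ⟨ξ, hξ⟩ := exists_oneFrom_notMem hp
  have hz := transition_mem_univ (oneFrom_mem_univ ξ) (bot_le (a := κ))
  have hsp := push_mem hz
    (ordModel_isKripkeModel.trans_assignment_mem le_rfl (push_mem hp hs))
  refine hξ ?_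
  rw [← transition_self hp]
  refine hpow κ le_rfl _ hz ((forces_isSubset hsp).2 fun μ hμ x hx hxz => ?_)
  change ordModel.mem μ x (transition μ (transition κ (oneFrom ξ))) at hxz
  change ordModel.mem μ x (transition μ (transition κ (s 0)))
  rw [transition_transition (oneFrom_mem_univ ξ) bot_le hμ, mem_oneFrom_iff hx] at hxz
  rw [transition_self (hs 0)]
  exact ((forces_isSingletonEmpty hs).1 h μ hμ x hx).2 hxz.2

theorem forces_isSingletonEmpty_kripkeOne (hs : ∀ n, s n ∈ ordModel.univ κ)
    (h : s 0 = transition κ kripkeOne) : ordModel.Forces κ s (isSingletonEmpty 0) := by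
  refine (forces_isSingletonEmpty hs).2 fun μ hμ x hx => ?_
  rw [h, ← oneFrom_zero, transition_transition (oneFrom_mem_univ 0) bot_le hμ,
    mem_oneFrom_iff hx]
  exact and_iff_right bot_le

theorem kripkeOne_mem_univ : kripkeOne.{u} ∈ ordModel.univ 0 :=
  oneFrom_zero ▸ oneFrom_mem_univ 0

/-- The assignment `s` need not take values in the universe. Only the variable `0` occurs free, so
renaming reduces to a constant assignment; `forces_oneFrom_subset` does the same with two variables.
-/
theorem forces_kripkeOne (s : ℕ → ZFSet.{u}) :
    ordModel.Forces 0 (push kripkeOne s) (isSingletonEmpty 0) := by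
  have h : ordModel.Forces 0 (fun _ => kripkeOne.{u}) (isSingletonEmpty 0) :=
    forces_isSingletonEmpty_kripkeOne (fun _ => kripkeOne_mem_univ)
      (transition_self kripkeOne_mem_univ).symm
  exact (forces_rename (isSingletonEmpty 0) (fun _ => 0) 0 (push kripkeOne s)).2 h

theorem forces_oneFrom_subset (κ : Ordinal.{u}) (s : ℕ → ZFSet.{u}) :
    ordModel.Forces 0 (push (oneFrom κ) (push kripkeOne s)) (isSubset 0 1) := by
  have h : ordModel.Forces 0 (push (oneFrom κ) fun _ => kripkeOne) (isSubset 0 1) := by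
    refine (forces_isSubset (push_mem (oneFrom_mem_univ κ) fun _ => kripkeOne_mem_univ)).2
      fun μ _ x hx hxκ => ?_
    change ordModel.mem μ x (transition μ kripkeOne)
    rw [← oneFrom_zero, mem_oneFrom_iff hx]
    exact ⟨bot_le, ((mem_oneFrom_iff hx).1 hxκ).2⟩
  refine (forces_rename (isSubset 0 1) (fun n => min n 1) 0 _).2 ?_
  convert h using 1
  funext n
  cases n with
  | zero => rfl
  | succ n => simp [push]

theorem models_not_hasPowerSet :
    ordModel.{u}.Models (.all ((isSingletonEmpty 0).imp (hasPowerSet 0).neg)) := by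
  refine ordModel_isKripkeModel.models_all fun κ s hs a ha μ hμ h ν hν h' => ?_
  have hA := ordModel_isKripkeModel.trans_assignment_mem hμ (push_mem ha hs)
  exact not_forces_hasPowerSet (ordModel_isKripkeModel.trans_assignment_mem hν hA)
    (ordModel_isKripkeModel.forces_mono hν hA h) h'

theorem models_neg_axPowerSet : ordModel.{u}.Models axPowerSet.neg := by
  intro κ s hs μ hμ h
  have hone := transition_mem_univ kripkeOne_mem_univ (bot_le (a := μ))
  have hA := push_mem hone (ordModel_isKripkeModel.trans_assignment_mem le_rfl
    (ordModel_isKripkeModel.trans_assignment_mem hμ hs))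
  exact not_forces_hasPowerSet hA (forces_isSingletonEmpty_kripkeOne hA rfl) (h μ le_rfl _ hone)

/-- Derivability involves no universe level, so the model over `ZFSet.{0}` suffices. -/
theorem not_prf_axPowerSet : ¬ Prf (CZF ∪ IZFMinusPowerSet) [] axPowerSet := by
  intro h
  have hs : ∀ n : ℕ, (fun _ => kripkeOne.{0} : ℕ → ZFSet.{0}) n ∈ ordModel.univ 0 :=
    fun _ => kripkeOne_mem_univ
  have hp := ordModel_isKripkeModel.{0}.sound
    (fun φ hφ => hφ.elim models_CZF models_IZFMinusPowerSet) h 0 _ hs (by simp)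
  exact ordModel_isKripkeModel.forces_imp hs (models_neg_axPowerSet 0 _ hs) hp

end PowerSet

end KripkeCZF

theorem mainTheorem1 :
    -- the full model on the ordinals is a Kripke model
    ordModel.{u}.IsKripkeModel ∧
    -- it satisfies CZF and, with full Separation, IZF minus Power Set
    (∀ φ ∈ CZF, ordModel.{u}.Models φ) ∧
    (∀ φ ∈ IZFMinusPowerSet, ordModel.{u}.Models φ) ∧
    -- Power Set fails
    ordModel.{u}.Models axPowerSet.neg ∧
    -- internally, `{∅}` has no power set
    ordModel.{u}.Models (.all ((isSingletonEmpty 0).imp (hasPowerSet 0).neg)) ∧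
    -- the Kripke set `1` is `{∅}`
    kripkeOne.{u} ∈ ordModel.{u}.univ 0 ∧
    (∀ s, ordModel.{u}.Forces 0 (KripkeStructure.push kripkeOne s) (isSingletonEmpty 0)) ∧
    -- every `1_κ` is a subset of `1`
    (∀ κ, oneFrom.{u} κ ∈ ordModel.{u}.univ 0 ∧
      ∀ s, ordModel.{u}.Forces 0
        (KripkeStructure.push (oneFrom κ) (KripkeStructure.push kripkeOne s)) (isSubset 0 1)) ∧
    -- at no node is there a set that contains all `1_κ`
    (∀ σ, ∀ x ∈ ordModel.{u}.univ σ,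
      ∃ κ, ¬ ordModel.{u}.mem σ (ordModel.{u}.trans 0 σ (oneFrom κ)) x) ∧
    -- Power Set is not derivable from Subset Collection over IZF minus Power Set
    ¬ Prf (CZF ∪ IZFMinusPowerSet) [] axPowerSet :=
  ⟨ordModel_isKripkeModel, fun _ => models_CZF, fun _ => models_IZFMinusPowerSet,
    models_neg_axPowerSet, models_not_hasPowerSet, kripkeOne_mem_univ, forces_kripkeOne,
    fun κ => ⟨oneFrom_mem_univ κ, forces_oneFrom_subset κ⟩,
    fun _ _ hx => exists_oneFrom_notMem hx, not_prf_axPowerSet⟩
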